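/- Let $F$ be a field of characteristic zero, let $n\ge 0$ be an integer and let $x\in F$. A diagram is a graph on $2n$ vertices, arranged in a top row $1,\dots,n$ and a bottom row $1',\dots,n'$, in which every vertex has degree zero or one (isolated vertices are drawn with a loop). For diagrams $a,b$ let $G(a,b)$ be the graph obtained by placing $a$ above $b$ and joining, for each $i$, the $i$-th bottom vertex of $a$ to the $i$-th top vertex of $b$. Let $\ell(a,b)$ be the number of connected components of $G(a,b)$ that contain neither a top vertex of $a$ nor a bottom vertex of $b$, and let $G'(a,b)$ be the diagram on the top vertices of $a$ and the bottom vertices of $b$ in which two different vertices are joined if and only if they are connected by a path in $G(a,b)$. The algebra $\mathbb{A}_n(x)$ is the $F$-vector space with basis the set of diagrams and with the associative unital multiplication that extends $a\cdot b=x^{\ell(a,b)}\,G'(a,b)$ bilinearly, and $\mathbb{L}_n(x)\subseteq\mathbb{A}_n(x)$ is the subalgebra spanned by the diagrams without horizontal arcs, i.e. those in which no two top vertices and no two bottom vertices are joined. **Theorem.** If $x\neq 0$, then $\mathbb{L}_n(x)$ is semisimple, in the sense that it is isomorphic as an $F$-algebra to a finite direct sum $\bigoplus_{i=1}^{k} M_{d_i}(F)$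 of full matrix algebras over $F$ with all $d_i\ge 1$. -/

import Mathlib

namespace LoopBrauer

/-- The `2n` vertices of a diagram: `Sum.inl i` is the top vertex `i`, `Sum.inr i` is the bottom
vertex `i'`. -/
abbrev Vertex (n : ℕ) : Type := Fin n ⊕ Fin n

/-- A diagram on `2n` vertices (a partial `1`-factor): a graph in which every vertex has degree
zero or one. The isolated vertices are the ones that are drawn with a loop. -/
@[ext]
structure Diagram (n : ℕ) where
  /-- The underlying graph. -/
  graph : SimpleGraph (Vertex n)
  /-- Every vertex has at most one neighbour. -/
  unique : ∀ u v w, graph.Adj u v → graph.Adj u w → v = w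

/-- A diagram without horizontal arcs: no two top vertices and no two bottom vertices are joined. -/
def Diagram.NoHorizontal {n : ℕ} (a : Diagram n) : Prop :=
  (∀ i j, ¬ a.graph.Adj (Sum.inl i) (Sum.inl j)) ∧ (∀ i j, ¬ a.graph.Adj (Sum.inr i) (Sum.inr j))

variable {n : ℕ}

/-- The arcs of the graph obtained by putting the diagram `a` above the diagram `b`. The vertices
of `a` are tagged with `Sum.inl`, those of `b` with `Sum.inr`, and the `i`-th bottom vertex of `a`
is joined to the `i`-th top vertex of `b`. -/
inductive StackAdj (a b : Diagram n) : Vertex n ⊕ Vertex n → Vertex n ⊕ Vertex n → Prop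
  | upper {u v : Vertex n} : a.graph.Adj u v → StackAdj a b (Sum.inl u) (Sum.inl v)
  | lower {u v : Vertex n} : b.graph.Adj u v → StackAdj a b (Sum.inr u) (Sum.inr v)
  | down (i : Fin n) : StackAdj a b (Sum.inl (Sum.inr i)) (Sum.inr (Sum.inl i))
  | up (i : Fin n) : StackAdj a b (Sum.inr (Sum.inl i)) (Sum.inl (Sum.inr i))

/-- The graph `G(a, b)`: the diagram `a` above the diagram `b`. -/
def stack (a b : Diagram n) : SimpleGraph (Vertex n ⊕ Vertex n) where
  Adj := StackAdj a b
  symm := ⟨by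
    rintro _ _ (h | h | i | i)
    · exact .upper h.symm
    · exact .lower h.symm
    · exact .up i
    · exact .down i⟩
  loopless := ⟨by
    rintro (u | u) h
    · cases h with | upper h => exact h.ne rfl
    · cases h with | lower h => exact h.ne rfl⟩

/-- The outer vertices of `G(a, b)`: the top row of `a` and the bottom row of `b`. -/
def outer : Vertex n → Vertex n ⊕ Vertex n
  | Sum.inl i => Sum.inl (Sum.inl i)
  | Sum.inr i => Sum.inr (Sum.inr i)

/-- The number of connected components of `G` that contain no vertex in the range of `o`. -/
noncomputable def innerCount {V O : Type} (G : SimpleGraph V) (o : O → V) : ℕ :=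
  Nat.card {c : G.ConnectedComponent // ∀ u, G.connectedComponentMk (o u) ≠ c}

/-- The number `ℓ(a, b)` of components of `G(a, b)` without outer vertices. -/
noncomputable def loops (a b : Diagram n) : ℕ := innerCount (stack a b) outer

/-- The partner of a vertex in a diagram (the vertex itself if it is isolated). -/
theorem exists_partner (a : Diagram n) :
    ∃ f : Vertex n → Vertex n, (∀ u, f (f u) = u) ∧ ∀ u v, a.graph.Adj u v → f u = v := by
  classical
  have key : ∀ u, ∃ v, (∀ w, a.graph.Adj u w → w = v) ∧ (v = u ∧ (∀ w, ¬ a.graph.Adj u w) ∨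
      a.graph.Adj u v) := by
    intro u
    by_cases h : ∃ v, a.graph.Adj u v
    · obtain ⟨v, hv⟩ := h
      exact ⟨v, fun w hw => a.unique _ _ _ hw hv, .inr hv⟩
    · push Not at h
      exact ⟨u, fun w hw => (h w hw).elim, .inl ⟨rfl, h⟩⟩
  choose f hf1 hf2 using key
  refine ⟨f, fun u => ?_, fun u v h => (hf1 u v h).symm⟩
  rcases hf2 u with ⟨h, -⟩ | h
  · rw [h, h]
  · exact (hf1 _ _ h.symm).symm

/-- In `G(a, b)` at most two outer vertices lie in the same component. -/
theorem stack_unique (a b : Diagram n) (u v w : Vertex n) (huv : u ≠ v) (huw : u ≠ w)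
    (hv : (stack a b).Reachable (outer u) (outer v))
    (hw : (stack a b).Reachable (outer u) (outer w)) : v = w := by
  obtain ⟨fa, hfa, hfa'⟩ := exists_partner a
  obtain ⟨fb, hfb, hfb'⟩ := exists_partner b
  have houter : Function.Injective (outer (n := n)) := by
    rintro (i | i) (j | j) h <;> simp_all [outer]
  let f : Equiv.Perm (Vertex n ⊕ Vertex n) :=
    Function.Involutive.toPerm (Sum.map fa fb) (by rintro (u | u) <;> simp [hfa, hfb])
  let g0 : Vertex n ⊕ Vertex n → Vertex n ⊕ Vertex n
    | Sum.inl (Sum.inl i) => Sum.inl (Sum.inl i)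
    | Sum.inl (Sum.inr i) => Sum.inr (Sum.inl i)
    | Sum.inr (Sum.inl i) => Sum.inl (Sum.inr i)
    | Sum.inr (Sum.inr i) => Sum.inr (Sum.inr i)
  let g : Equiv.Perm (Vertex n ⊕ Vertex n) :=
    Function.Involutive.toPerm g0 (by rintro ((i | i) | (i | i)) <;> rfl)
  have hff : f * f = 1 := by ext x; simp [f, Function.Involutive.toPerm]; rcases x with x | x <;> simp [hfa, hfb]
  have hgg : g * g = 1 := by
    ext x; simp only [Equiv.Perm.mul_apply, Equiv.Perm.one_apply]
    rcases x with (x | x) | (x | x) <;> rfl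
  have hfi : f⁻¹ = f := inv_eq_of_mul_eq_one_left hff
  have hgi : g⁻¹ = g := inv_eq_of_mul_eq_one_left hgg
  have hg : ∀ u, g (outer u) = outer u := by rintro (i | i) <;> rfl
  set h := f * g with hh
  have hfh : ∀ k : ℤ, f * h ^ k = h ^ (-k) * f := by
    intro k
    have h1 : f * h * f⁻¹ = h⁻¹ := by
      rw [hh, mul_inv_rev, hfi, hgi, ← mul_assoc, hff, one_mul]
    rw [zpow_neg, ← inv_zpow, ← h1, conj_zpow, inv_mul_cancel_right]
  have hgh : ∀ k : ℤ, g * h ^ k = h ^ (-k) * g := by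
    intro k
    have h1 : g * h * g⁻¹ = h⁻¹ := by
      rw [hh, mul_inv_rev, hfi, hgi, mul_assoc, mul_assoc, hgg, mul_one]
    rw [zpow_neg, ← inv_zpow, ← h1, conj_zpow, inv_mul_cancel_right]
  have orbit : ∀ z, (stack a b).Reachable (outer u) z → ∃ k : ℤ, z = (h ^ k) (outer u) := by
    intro z hz
    rw [SimpleGraph.reachable_iff_reflTransGen] at hz
    induction hz with
    | refl => exact ⟨0, by simp⟩
    | @tail y z _ hyz ih =>
      obtain ⟨k, rfl⟩ := ih
      have hfz : f ((h ^ k) (outer u)) = z ∨ g ((h ^ k) (outer u)) = z := by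
        generalize (h ^ k) (outer u) = y at hyz
        rcases hyz with hyz | hyz | i | i
        · left; simp [f, Function.Involutive.toPerm, hfa' _ _ hyz]
        · left; simp [f, Function.Involutive.toPerm, hfb' _ _ hyz]
        · right; rfl
        · right; rfl
      rcases hfz with hfz | hfz
      · refine ⟨-k + 1, ?_⟩
        rw [← hfz, ← Equiv.Perm.mul_apply, hfh, zpow_add, zpow_one, Equiv.Perm.mul_apply,
          Equiv.Perm.mul_apply, hh, Equiv.Perm.mul_apply, hg]
      · refine ⟨-k, ?_⟩
        rw [← hfz, ← Equiv.Perm.mul_apply, hgh, Equiv.Perm.mul_apply, hg]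
  have period : ∀ (z : Vertex n) (k : ℤ), outer z = (h ^ k) (outer u) →
      (h ^ (2 * k)) (outer u) = outer u := by
    intro z k hz
    have h1 := hg z
    rw [hz, ← Equiv.Perm.mul_apply, hgh, Equiv.Perm.mul_apply, hg] at h1
    rw [two_mul, zpow_add, Equiv.Perm.mul_apply, ← h1, ← Equiv.Perm.mul_apply, ← zpow_add]
    simp
  obtain ⟨k, hk⟩ := orbit _ hv
  obtain ⟨l, hl⟩ := orbit _ hw
  have hk2 := period _ _ hk
  have hl2 := period _ _ hl
  have dvd_iff : ∀ m : ℤ, (h ^ m) (outer u) = outer u ↔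
      (Function.minimalPeriod (h • ·) (outer u) : ℤ) ∣ m := by
    intro m
    rw [← MulAction.zpow_smul_eq_iff_minimalPeriod_dvd (a := h) (b := outer u) (n := m)]
    rfl
  have hk1 : ¬ ((Function.minimalPeriod (h • ·) (outer u) : ℤ) ∣ k) := by
    rw [← dvd_iff, ← hk]; exact fun e => huv (houter e).symm
  have hl1 : ¬ ((Function.minimalPeriod (h • ·) (outer u) : ℤ) ∣ l) := by
    rw [← dvd_iff, ← hl]; exact fun e => huw (houter e).symm
  rw [dvd_iff] at hk2 hl2
  have hkl : (Function.minimalPeriod (h • ·) (outer u) : ℤ) ∣ k - l := by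
    generalize (Function.minimalPeriod (h • ·) (outer u) : ℤ) = p at *
    obtain ⟨r, hr⟩ := hk2
    obtain ⟨s, hs⟩ := hl2
    rcases Int.even_or_odd' r with ⟨r', rfl | rfl⟩
    · exact (hk1 ⟨r', by linarith⟩).elim
    rcases Int.even_or_odd' s with ⟨s', rfl | rfl⟩
    · exact (hl1 ⟨s', by linarith⟩).elim
    exact ⟨r' - s', by linarith⟩
  rw [← dvd_iff] at hkl
  apply houter
  rw [hk, hl]
  have : k = l + (k - l) := by ring
  rw [this, zpow_add, Equiv.Perm.mul_apply, hkl]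

/-- The diagram `G'(a, b)`: two different outer vertices of `G(a, b)` are joined by an arc if and
only if they are connected by a path in `G(a, b)`. -/
def Diagram.comp (a b : Diagram n) : Diagram n where
  graph :=
    { Adj := fun u v => u ≠ v ∧ (stack a b).Reachable (outer u) (outer v)
      symm := ⟨fun _ _ h => ⟨h.1.symm, h.2.symm⟩⟩
      loopless := ⟨fun _ h => h.1 rfl⟩ }
  unique := fun u v w h h' => stack_unique a b u v w h.1 h'.1 h.2 h'.2

/-- The diagram with the vertical arcs `(i, i')` only. -/
def Diagram.id (n : ℕ) : Diagram n where
  graph :=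
    { Adj := fun u v => v = u.swap ∧ u ≠ v
      symm := ⟨fun _ _ h => ⟨by simp [h.1], h.2.symm⟩⟩
      loopless := ⟨fun _ h => h.2 rfl⟩ }
  unique := fun _ _ _ h h' => h.1.trans h'.1.symm

theorem Diagram.reachable_iff (a : Diagram n) (u v : Vertex n) :
    a.graph.Reachable u v ↔ u = v ∨ a.graph.Adj u v := by
  refine ⟨fun h => ?_, ?_⟩
  · rw [SimpleGraph.reachable_iff_reflTransGen] at h
    induction h with
    | refl => exact .inl rfl
    | tail _ h2 ih =>
      rcases ih with rfl | ih
      · exact .inr h2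
      · exact .inl (a.unique _ _ _ ih.symm h2)
  · rintro (rfl | h)
    · exact .rfl
    · exact h.reachable

theorem comp_reachable_iff (a b : Diagram n) (u v : Vertex n) :
    (a.comp b).graph.Reachable u v ↔ (stack a b).Reachable (outer u) (outer v) := by
  rw [Diagram.reachable_iff]
  refine ⟨?_, fun h => ?_⟩
  · rintro (rfl | h)
    · exact .rfl
    · exact h.2
  · by_cases e : u = v
    · exact .inl e
    · exact .inr ⟨e, h⟩

theorem reachable_of_map {V W : Type} {G : SimpleGraph V} {H : SimpleGraph W} (i : V → W)
    (hi : ∀ x y, G.Adj x y → H.Reachable (i x) (i y)) {x y : V} (h : G.Reachable x y) :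
    H.Reachable (i x) (i y) := by
  rw [SimpleGraph.reachable_iff_reflTransGen] at h
  induction h with
  | refl => exact .rfl
  | tail _ h2 ih => exact ih.trans (hi _ _ h2)

theorem innerCount_eq_zero {V O : Type} (G : SimpleGraph V) (o : O → V)
    (h : ∀ v, ∃ u, G.Reachable (o u) v) : innerCount G o = 0 := by
  rw [innerCount, Nat.card_eq_zero]
  left
  refine ⟨fun ⟨c, hc⟩ => ?_⟩
  induction c using SimpleGraph.ConnectedComponent.ind with | _ v =>
  obtain ⟨u, hu⟩ := h v
  exact hc u (SimpleGraph.ConnectedComponent.sound hu)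

theorem Diagram.ext_reachable {a b : Diagram n}
    (h : ∀ u v, a.graph.Reachable u v ↔ b.graph.Reachable u v) : a = b := by
  ext u v
  have := h u v
  rw [a.reachable_iff, b.reachable_iff] at this
  by_cases e : u = v
  · subst e; simp
  · simpa [e] using this

theorem id_adj (i : Fin n) : (Diagram.id n).graph.Adj (Sum.inl i) (Sum.inr i) :=
  ⟨rfl, by simp⟩

theorem id_comp (a : Diagram n) : (Diagram.id n).comp a = a := by
  apply Diagram.ext_reachable
  intro u v
  rw [comp_reachable_iff]
  let r : Vertex n ⊕ Vertex n → Vertex n := Sum.elim (fun u => Sum.inl (u.elim _root_.id _root_.id)) _root_.id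
  have hro : ∀ u, r (outer u) = u := by rintro (i | i) <;> rfl
  have hor : ∀ u, (stack (Diagram.id n) a).Reachable (outer u) (Sum.inr u) := by
    rintro (i | i)
    · exact (SimpleGraph.Adj.reachable (StackAdj.upper (id_adj i))).trans
        (SimpleGraph.Adj.reachable (StackAdj.down i))
    · exact .rfl
  constructor
  · intro h
    rw [← hro u, ← hro v]
    refine reachable_of_map r ?_ h
    rintro _ _ (h | h | i | i)
    · have := h.1
      rename_i x y
      subst this
      rcases x with x | x <;> exact .rfl
    · exact h.reachable
    · exact .rfl
    · exact .rfl
  · intro h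
    exact ((hor u).trans (reachable_of_map Sum.inr
      (fun x y h => SimpleGraph.Adj.reachable (StackAdj.lower h)) h)).trans (hor v).symm

theorem comp_id (a : Diagram n) : a.comp (Diagram.id n) = a := by
  apply Diagram.ext_reachable
  intro u v
  rw [comp_reachable_iff]
  let r : Vertex n ⊕ Vertex n → Vertex n := Sum.elim _root_.id (fun u => Sum.inr (u.elim _root_.id _root_.id))
  have hro : ∀ u, r (outer u) = u := by rintro (i | i) <;> rfl
  have hor : ∀ u, (stack a (Diagram.id n)).Reachable (outer u) (Sum.inl u) := by
    rintro (i | i)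
    · exact .rfl
    · exact (SimpleGraph.Adj.reachable (StackAdj.lower (id_adj i).symm)).trans
        (SimpleGraph.Adj.reachable (StackAdj.up i))
  constructor
  · intro h
    rw [← hro u, ← hro v]
    refine reachable_of_map r ?_ h
    rintro _ _ (h | h | i | i)
    · exact h.reachable
    · have := h.1
      rename_i x y
      subst this
      rcases x with x | x <;> exact .rfl
    · exact .rfl
    · exact .rfl
  · intro h
    exact ((hor u).trans (reachable_of_map Sum.inl
      (fun x y h => SimpleGraph.Adj.reachable (StackAdj.upper h)) h)).trans (hor v).symm

theorem loops_id_left (a : Diagram n) : loops (Diagram.id n) a = 0 := by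
  apply innerCount_eq_zero
  rintro ((i | i) | (i | i))
  · exact ⟨Sum.inl i, .rfl⟩
  · exact ⟨Sum.inl i, SimpleGraph.Adj.reachable (StackAdj.upper (id_adj i))⟩
  · exact ⟨Sum.inl i, (SimpleGraph.Adj.reachable (StackAdj.upper (id_adj i))).trans
      (SimpleGraph.Adj.reachable (StackAdj.down i))⟩
  · exact ⟨Sum.inr i, .rfl⟩

theorem loops_id_right (a : Diagram n) : loops a (Diagram.id n) = 0 := by
  apply innerCount_eq_zero
  rintro ((i | i) | (i | i))
  · exact ⟨Sum.inl i, .rfl⟩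
  · exact ⟨Sum.inr i, (SimpleGraph.Adj.reachable (StackAdj.lower (id_adj i).symm)).trans
      (SimpleGraph.Adj.reachable (StackAdj.up i))⟩
  · exact ⟨Sum.inr i, SimpleGraph.Adj.reachable (StackAdj.lower (id_adj i).symm)⟩
  · exact ⟨Sum.inr i, .rfl⟩

/-- Contracting a part `G` (with outer vertices `o`) of a graph `B` to its outer vertices yields a
graph `S` with the same connections, and the components of `B` that miss the outer vertices `q`
are those of `G` and those of `S`. -/
theorem contract {X V Y O Q : Type} [Finite V] [Finite Y]
    {B : SimpleGraph X} {G : SimpleGraph V} {S : SimpleGraph Y}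
    {i : V → X} {j : Y → X} {o : O → V} {e : O → Y}
    (hi : Function.Injective i) (hj : Function.Injective j)
    (hoe : ∀ u, i (o u) = j (e u)) (hij : ∀ v y, i v = j y → ∃ u, v = o u ∧ y = e u)
    (cover : ∀ x, (∃ v, x = i v) ∨ ∃ y, x = j y)
    (hB : ∀ x x', B.Adj x x' → (∃ v v', x = i v ∧ x' = i v' ∧ G.Adj v v') ∨
      ∃ y y', x = j y ∧ x' = j y' ∧ S.Adj y y')
    (hG : ∀ v v', G.Adj v v' → B.Adj (i v) (i v'))
    (hS : ∀ y y', S.Adj y y' → B.Reachable (j y) (j y'))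
    (hO : ∀ u u', G.Reachable (o u) (o u') → S.Reachable (e u) (e u')) (q : Q → Y) :
    (∀ y y', B.Reachable (j y) (j y') ↔ S.Reachable y y') ∧
      innerCount B (j ∘ q) = innerCount G o + innerCount S q := by
  have hGr : ∀ {v v'}, G.Reachable v v' → B.Reachable (i v) (i v') :=
    fun h => reachable_of_map i (fun x y h => (hG x y h).reachable) h
  have hSr : ∀ {y y'}, S.Reachable y y' → B.Reachable (j y) (j y') :=
    fun h => reachable_of_map j hS h
  have key : ∀ y x, B.Reachable (j y) x → (∃ y', x = j y' ∧ S.Reachable y y') ∨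
      ∃ v u, x = i v ∧ G.Reachable (o u) v ∧ S.Reachable y (e u) := by
    intro y x h
    rw [SimpleGraph.reachable_iff_reflTransGen] at h
    induction h with
    | refl => exact .inl ⟨y, rfl, .rfl⟩
    | @tail x x' _ h2 ih =>
      rcases hB _ _ h2 with ⟨v, v', rfl, rfl, hv⟩ | ⟨y1, y2, rfl, rfl, hy⟩
      · right
        rcases ih with ⟨y', hy', hr⟩ | ⟨w, u, hw, hr, hr'⟩
        · obtain ⟨u, rfl, rfl⟩ := hij _ _ hy'
          exact ⟨v', u, rfl, hv.reachable, hr⟩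
        · obtain rfl := hi hw
          exact ⟨v', u, rfl, hr.trans hv.reachable, hr'⟩
      · left
        refine ⟨y2, rfl, ?_⟩
        rcases ih with ⟨y', hy', hr⟩ | ⟨w, u, hw, hr, hr'⟩
        · obtain rfl := hj hy'
          exact hr.trans hy.reachable
        · obtain ⟨u', rfl, rfl⟩ := hij _ _ hw.symm
          exact (hr'.trans (hO _ _ hr)).trans hy.reachable
  have hreach : ∀ y y', B.Reachable (j y) (j y') ↔ S.Reachable y y' := by
    intro y y'
    refine ⟨fun h => ?_, hSr⟩
    rcases key _ _ h with ⟨y1, h1, hr⟩ | ⟨v, u, hv, hr, hr'⟩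
    · obtain rfl := hj h1
      exact hr
    · obtain ⟨u', rfl, rfl⟩ := hij _ _ hv.symm
      exact hr'.trans (hO _ _ hr)
  have key2 : ∀ v x, (∀ u, ¬ G.Reachable (o u) v) → B.Reachable (i v) x →
      ∃ v', x = i v' ∧ G.Reachable v v' := by
    intro v x hv h
    rw [SimpleGraph.reachable_iff_reflTransGen] at h
    induction h with
    | refl => exact ⟨v, rfl, .rfl⟩
    | @tail x x' _ h2 ih =>
      obtain ⟨w, rfl, hw⟩ := ih
      rcases hB _ _ h2 with ⟨v1, v', h1, rfl, hv'⟩ | ⟨y1, y2, h1, rfl, hy⟩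
      · obtain rfl := hi h1
        exact ⟨v', rfl, hw.trans hv'.reachable⟩
      · obtain ⟨u, rfl, rfl⟩ := hij _ _ h1
        exact (hv u hw.symm).elim
  refine ⟨hreach, ?_⟩
  let φ : {c : G.ConnectedComponent // ∀ u, G.connectedComponentMk (o u) ≠ c} ⊕
      {c : S.ConnectedComponent // ∀ u, S.connectedComponentMk (q u) ≠ c} →
      B.ConnectedComponent :=
    Sum.elim
      (fun c => c.1.lift (fun v => B.connectedComponentMk (i v)) (fun v w p _ =>
        SimpleGraph.ConnectedComponent.sound (hGr p.reachable)))
      (fun c => c.1.lift (fun v => B.connectedComponentMk (j v)) (fun v w p _ =>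
        SimpleGraph.ConnectedComponent.sound (hSr p.reachable)))
  have hφ : ∀ c u, B.connectedComponentMk ((j ∘ q) u) ≠ φ c := by
    rintro (⟨c, hc⟩ | ⟨c, hc⟩) u h
    · induction c using SimpleGraph.ConnectedComponent.ind with | _ v =>
      have hv : ∀ u, ¬ G.Reachable (o u) v :=
        fun u hu => hc u (SimpleGraph.ConnectedComponent.sound hu)
      have h' : B.Reachable (j (q u)) (i v) := SimpleGraph.ConnectedComponent.exact h
      obtain ⟨v', h1, h2⟩ := key2 v _ hv h'.symm
      obtain ⟨u', rfl, -⟩ := hij _ _ h1.symm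
      exact hv u' h2.symm
    · induction c using SimpleGraph.ConnectedComponent.ind with | _ y =>
      have h' : B.Reachable (j (q u)) (j y) := SimpleGraph.ConnectedComponent.exact h
      exact hc u (SimpleGraph.ConnectedComponent.sound ((hreach _ _).1 h'))
  let ψ : _ → {c : B.ConnectedComponent // ∀ u, B.connectedComponentMk ((j ∘ q) u) ≠ c} :=
    fun c => ⟨φ c, hφ c⟩
  have hψ : Function.Bijective ψ := by
    constructor
    · intro c c' h
      have h : φ c = φ c' := congrArg Subtype.val h
      rcases c with ⟨c, hc⟩ | ⟨c, hc⟩ <;> rcases c' with ⟨c', hc'⟩ | ⟨c', hc'⟩ <;>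
        induction c using SimpleGraph.ConnectedComponent.ind with | _ v <;>
        induction c' using SimpleGraph.ConnectedComponent.ind with | _ v'
      · have h' : B.Reachable (i v) (i v') := SimpleGraph.ConnectedComponent.exact h
        obtain ⟨w, h1, h2⟩ := key2 v _
          (fun u hu => hc u (SimpleGraph.ConnectedComponent.sound hu)) h'
        obtain rfl := hi h1
        congr 2
        exact SimpleGraph.ConnectedComponent.sound h2
      · have h' : B.Reachable (i v) (j v') := SimpleGraph.ConnectedComponent.exact h
        obtain ⟨w, h1, h2⟩ := key2 v _
          (fun u hu => hc u (SimpleGraph.ConnectedComponent.sound hu)) h'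
        obtain ⟨u, rfl, -⟩ := hij _ _ h1.symm
        exact (hc u (SimpleGraph.ConnectedComponent.sound h2.symm)).elim
      · have h' : B.Reachable (j v) (i v') := SimpleGraph.ConnectedComponent.exact h
        obtain ⟨w, h1, h2⟩ := key2 v' _
          (fun u hu => hc' u (SimpleGraph.ConnectedComponent.sound hu)) h'.symm
        obtain ⟨u, rfl, -⟩ := hij _ _ h1.symm
        exact (hc' u (SimpleGraph.ConnectedComponent.sound h2.symm)).elim
      · have h' : B.Reachable (j v) (j v') := SimpleGraph.ConnectedComponent.exact h
        congr 2
        exact SimpleGraph.ConnectedComponent.sound ((hreach _ _).1 h')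
    · rintro ⟨c, hc⟩
      induction c using SimpleGraph.ConnectedComponent.ind with | _ x =>
      have hy : ∀ y, B.Reachable (j y) x → ∃ c, φ c = B.connectedComponentMk x := by
        intro y hy
        refine ⟨Sum.inr ⟨S.connectedComponentMk y, fun u hu => hc u ?_⟩, ?_⟩
        · exact SimpleGraph.ConnectedComponent.sound
            ((hSr (SimpleGraph.ConnectedComponent.exact hu)).trans hy)
        · exact SimpleGraph.ConnectedComponent.sound hy
      have : ∃ c, φ c = B.connectedComponentMk x := by
        rcases cover x with ⟨v, rfl⟩ | ⟨y, rfl⟩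
        · by_cases hv : ∃ u, G.Reachable (o u) v
          · obtain ⟨u, hu⟩ := hv
            exact hy (e u) (hoe u ▸ hGr hu)
          · push Not at hv
            exact ⟨Sum.inl ⟨G.connectedComponentMk v,
              fun u hu => hv u (SimpleGraph.ConnectedComponent.exact hu)⟩, rfl⟩
        · exact hy y .rfl
      obtain ⟨c, hc'⟩ := this
      exact ⟨c, Subtype.ext hc'⟩
  have hfG : Finite G.ConnectedComponent := Quot.finite _
  have hfS : Finite S.ConnectedComponent := Quot.finite _
  rw [innerCount, innerCount, innerCount, ← Nat.card_sum]
  exact (Nat.card_congr (Equiv.ofBijective ψ hψ)).symm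

/-- Three diagrams on top of each other. -/
inductive StackAdj₃ (a b c : Diagram n) :
    Vertex n ⊕ Vertex n ⊕ Vertex n → Vertex n ⊕ Vertex n ⊕ Vertex n → Prop
  | upper {u v : Vertex n} : a.graph.Adj u v → StackAdj₃ a b c (Sum.inl u) (Sum.inl v)
  | middle {u v : Vertex n} : b.graph.Adj u v →
      StackAdj₃ a b c (Sum.inr (Sum.inl u)) (Sum.inr (Sum.inl v))
  | lower {u v : Vertex n} : c.graph.Adj u v →
      StackAdj₃ a b c (Sum.inr (Sum.inr u)) (Sum.inr (Sum.inr v))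
  | down (i : Fin n) : StackAdj₃ a b c (Sum.inl (Sum.inr i)) (Sum.inr (Sum.inl (Sum.inl i)))
  | up (i : Fin n) : StackAdj₃ a b c (Sum.inr (Sum.inl (Sum.inl i))) (Sum.inl (Sum.inr i))
  | down' (i : Fin n) :
      StackAdj₃ a b c (Sum.inr (Sum.inl (Sum.inr i))) (Sum.inr (Sum.inr (Sum.inl i)))
  | up' (i : Fin n) :
      StackAdj₃ a b c (Sum.inr (Sum.inr (Sum.inl i))) (Sum.inr (Sum.inl (Sum.inr i)))

/-- The graph of three diagrams on top of each other. -/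
def stack₃ (a b c : Diagram n) : SimpleGraph (Vertex n ⊕ Vertex n ⊕ Vertex n) where
  Adj := StackAdj₃ a b c
  symm := ⟨by
    rintro _ _ (h | h | h | i | i | i | i)
    · exact .upper h.symm
    · exact .middle h.symm
    · exact .lower h.symm
    · exact .up i
    · exact .down i
    · exact .up' i
    · exact .down' i⟩
  loopless := ⟨by
    rintro (u | u | u) h
    · cases h with | upper h => exact h.ne rfl
    · cases h with | middle h => exact h.ne rfl
    · cases h with | lower h => exact h.ne rfl⟩

/-- The outer vertices of three diagrams on top of each other. -/
def outer₃ : Vertex n → Vertex n ⊕ Vertex n ⊕ Vertex n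
  | Sum.inl i => Sum.inl (Sum.inl i)
  | Sum.inr i => Sum.inr (Sum.inr (Sum.inr i))

theorem stack_left (a b c : Diagram n) :
    (∀ u v, (stack₃ a b c).Reachable (outer₃ u) (outer₃ v) ↔
      ((a.comp b).comp c).graph.Reachable u v) ∧
      innerCount (stack₃ a b c) outer₃ = loops a b + loops (a.comp b) c := by
  let i : Vertex n ⊕ Vertex n → Vertex n ⊕ Vertex n ⊕ Vertex n := Sum.map _root_.id Sum.inl
  let j : Vertex n ⊕ Vertex n → Vertex n ⊕ Vertex n ⊕ Vertex n :=
    Sum.elim (Sum.elim (Sum.inl ∘ Sum.inl) (Sum.inr ∘ Sum.inl ∘ Sum.inr)) (Sum.inr ∘ Sum.inr)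
  have ho : outer₃ = j ∘ outer (n := n) := by funext u; rcases u with u | u <;> rfl
  have hGB : ∀ v v', (stack a b).Adj v v' → (stack₃ a b c).Adj (i v) (i v') := by
    rintro _ _ (h | h | k | k)
    · exact .upper h
    · exact .middle h
    · exact .down k
    · exact .up k
  have hoe : ∀ u : Vertex n, i (outer u) = j (Sum.inl u) := by rintro (u | u) <;> rfl
  have := contract (B := stack₃ a b c) (G := stack a b) (S := stack (a.comp b) c)
    (i := i) (j := j) (o := outer) (e := Sum.inl)
    (by rintro ((u | u) | (u | u)) ((v | v) | (v | v)) h <;> cases h <;> rfl)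
    (by rintro ((u | u) | (u | u)) ((v | v) | (v | v)) h <;> cases h <;> rfl)
    hoe
    (by
      rintro ((u | u) | (u | u)) ((v | v) | (v | v)) h <;> cases h
      · exact ⟨Sum.inl u, rfl, rfl⟩
      · exact ⟨Sum.inr u, rfl, rfl⟩)
    (by
      rintro ((u | u) | (u | u) | u)
      · exact .inl ⟨Sum.inl (Sum.inl u), rfl⟩
      · exact .inl ⟨Sum.inl (Sum.inr u), rfl⟩
      · exact .inl ⟨Sum.inr (Sum.inl u), rfl⟩
      · exact .inl ⟨Sum.inr (Sum.inr u), rfl⟩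
      · exact .inr ⟨Sum.inr u, rfl⟩)
    (by
      rintro _ _ (h | h | h | k | k | k | k)
      · exact .inl ⟨_, _, rfl, rfl, .upper h⟩
      · exact .inl ⟨_, _, rfl, rfl, .lower h⟩
      · exact .inr ⟨_, _, rfl, rfl, .lower h⟩
      · exact .inl ⟨_, _, rfl, rfl, .down k⟩
      · exact .inl ⟨_, _, rfl, rfl, .up k⟩
      · exact .inr ⟨_, _, rfl, rfl, .down k⟩
      · exact .inr ⟨_, _, rfl, rfl, .up k⟩)
    hGB
    (by
      rintro _ _ (h | h | k | k)
      · rw [← hoe, ← hoe]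
        exact reachable_of_map i (fun x y h => (hGB x y h).reachable) h.2
      · exact SimpleGraph.Adj.reachable (StackAdj₃.lower h)
      · exact SimpleGraph.Adj.reachable (StackAdj₃.down' k)
      · exact SimpleGraph.Adj.reachable (StackAdj₃.up' k))
    (fun u u' h => reachable_of_map Sum.inl
      (fun x y h => SimpleGraph.Adj.reachable (StackAdj.upper h))
      ((comp_reachable_iff a b u u').2 h))
    outer
  rw [ho]
  refine ⟨fun u v => ?_, this.2⟩
  rw [comp_reachable_iff, ← this.1]
  rfl

theorem stack_right (a b c : Diagram n) :
    (∀ u v, (stack₃ a b c).Reachable (outer₃ u) (outer₃ v) ↔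
      (a.comp (b.comp c)).graph.Reachable u v) ∧
      innerCount (stack₃ a b c) outer₃ = loops b c + loops a (b.comp c) := by
  let i : Vertex n ⊕ Vertex n → Vertex n ⊕ Vertex n ⊕ Vertex n := Sum.inr
  let j : Vertex n ⊕ Vertex n → Vertex n ⊕ Vertex n ⊕ Vertex n :=
    Sum.elim Sum.inl (Sum.elim (Sum.inr ∘ Sum.inl ∘ Sum.inl) (Sum.inr ∘ Sum.inr ∘ Sum.inr))
  have ho : outer₃ = j ∘ outer (n := n) := by funext u; rcases u with u | u <;> rfl
  have hGB : ∀ v v', (stack b c).Adj v v' → (stack₃ a b c).Adj (i v) (i v') := by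
    rintro _ _ (h | h | k | k)
    · exact .middle h
    · exact .lower h
    · exact .down' k
    · exact .up' k
  have hoe : ∀ u : Vertex n, i (outer u) = j (Sum.inr u) := by rintro (u | u) <;> rfl
  have := contract (B := stack₃ a b c) (G := stack b c) (S := stack a (b.comp c))
    (i := i) (j := j) (o := outer) (e := Sum.inr)
    Sum.inr_injective
    (by rintro ((u | u) | (u | u)) ((v | v) | (v | v)) h <;> cases h <;> rfl)
    hoe
    (by
      rintro ((u | u) | (u | u)) ((v | v) | (v | v)) h <;> cases h
      · exact ⟨Sum.inl u, rfl, rfl⟩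
      · exact ⟨Sum.inr u, rfl, rfl⟩)
    (by
      rintro (u | u)
      · exact .inr ⟨Sum.inl u, rfl⟩
      · exact .inl ⟨u, rfl⟩)
    (by
      rintro _ _ (h | h | h | k | k | k | k)
      · exact .inr ⟨_, _, rfl, rfl, .upper h⟩
      · exact .inl ⟨_, _, rfl, rfl, .upper h⟩
      · exact .inl ⟨_, _, rfl, rfl, .lower h⟩
      · exact .inr ⟨_, _, rfl, rfl, .down k⟩
      · exact .inr ⟨_, _, rfl, rfl, .up k⟩
      · exact .inl ⟨_, _, rfl, rfl, .down k⟩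
      · exact .inl ⟨_, _, rfl, rfl, .up k⟩)
    hGB
    (by
      rintro _ _ (h | h | k | k)
      · exact SimpleGraph.Adj.reachable (StackAdj₃.upper h)
      · rw [← hoe, ← hoe]
        exact reachable_of_map i (fun x y h => (hGB x y h).reachable) h.2
      · exact SimpleGraph.Adj.reachable (StackAdj₃.down k)
      · exact SimpleGraph.Adj.reachable (StackAdj₃.up k))
    (fun u u' h => reachable_of_map Sum.inr
      (fun x y h => SimpleGraph.Adj.reachable (StackAdj.lower h))
      ((comp_reachable_iff b c u u').2 h))
    outer
  rw [ho]
  refine ⟨fun u v => ?_, this.2⟩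
  rw [comp_reachable_iff, ← this.1]
  rfl

theorem comp_assoc (a b c : Diagram n) : (a.comp b).comp c = a.comp (b.comp c) :=
  Diagram.ext_reachable fun u v =>
    ((stack_left a b c).1 u v).symm.trans ((stack_right a b c).1 u v)

theorem loops_assoc (a b c : Diagram n) :
    loops a b + loops (a.comp b) c = loops b c + loops a (b.comp c) :=
  (stack_left a b c).2.symm.trans (stack_right a b c).2

/-- The algebra `𝔸_n(x)`: the `F`-vector space with basis the diagrams on `2n` vertices, with the
multiplication that extends `a · b = x ^ ℓ(a, b) G'(a, b)` bilinearly. -/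
def DiagramAlgebra (n : ℕ) (F : Type*) [Field F] (_x : F) : Type _ := Diagram n →₀ F

namespace DiagramAlgebra

variable {F : Type*} [Field F] {x : F}

noncomputable instance : AddCommGroup (DiagramAlgebra n F x) :=
  inferInstanceAs (AddCommGroup (Diagram n →₀ F))

noncomputable instance : Module F (DiagramAlgebra n F x) :=
  inferInstanceAs (Module F (Diagram n →₀ F))

/-- The basis element of a diagram. -/
noncomputable def of (x : F) (a : Diagram n) : DiagramAlgebra n F x :=
  (Finsupp.single a 1 : Diagram n →₀ F)

/-- The diagrams form a basis. -/
noncomputable def basis (n : ℕ) (x : F) : Module.Basis (Diagram n) F (DiagramAlgebra n F x) :=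
  .ofRepr (LinearEquiv.refl F (Diagram n →₀ F))

@[simp]
theorem basis_apply (a : Diagram n) : basis n x a = of x a := rfl

/-- The bilinear extension of the product of diagrams. -/
noncomputable def mulBilin (n : ℕ) (x : F) :
    DiagramAlgebra n F x →ₗ[F] DiagramAlgebra n F x →ₗ[F] DiagramAlgebra n F x :=
  (basis n x).constr F fun a => (basis n x).constr F fun b => x ^ loops a b • of x (a.comp b)

theorem mulBilin_of (a b : Diagram n) :
    mulBilin n x (of x a) (of x b) = x ^ loops a b • of x (a.comp b) := by
  rw [mulBilin, ← basis_apply a, Module.Basis.constr_basis, ← basis_apply b,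
    Module.Basis.constr_basis]

theorem induction {p : DiagramAlgebra n F x → Prop} (f : DiagramAlgebra n F x)
    (hof : ∀ a, p (of x a)) (hzero : p 0) (hadd : ∀ f g, p f → p g → p (f + g))
    (hsmul : ∀ (r : F) f, p f → p (r • f)) : p f := by
  have hf : f ∈ Submodule.span F (Set.range (basis n x)) := by
    rw [Module.Basis.span_eq]; trivial
  induction hf using Submodule.span_induction with
  | mem f h =>
    obtain ⟨a, rfl⟩ := h
    exact hof a
  | zero => exact hzero
  | add f g _ _ hf hg => exact hadd f g hf hg
  | smul r f _ hf => exact hsmul r f hf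

theorem mulBilin_assoc (f g h : DiagramAlgebra n F x) :
    mulBilin n x (mulBilin n x f g) h = mulBilin n x f (mulBilin n x g h) := by
  induction f using induction with
  | hzero => simp
  | hadd f f' hf hf' => simp [hf, hf']
  | hsmul r f hf => simp [hf]
  | hof a =>
    induction g using induction with
    | hzero => simp
    | hadd g g' hg hg' => simp [hg, hg']
    | hsmul r g hg => simp [hg]
    | hof b =>
      induction h using induction with
      | hzero => simp
      | hadd h h' hh hh' => simp [hh, hh']
      | hsmul r h hh => simp [hh]
      | hof c =>
        simp only [mulBilin_of, map_smul, LinearMap.smul_apply, smul_smul, ← pow_add]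
        rw [loops_assoc, comp_assoc]

theorem one_mulBilin (f : DiagramAlgebra n F x) :
    mulBilin n x (of x (Diagram.id n)) f = f := by
  induction f using induction with
  | hzero => simp
  | hadd f f' hf hf' => simp [hf, hf']
  | hsmul r f hf => simp [hf]
  | hof a => rw [mulBilin_of, id_comp, loops_id_left, pow_zero, one_smul]

theorem mulBilin_one (f : DiagramAlgebra n F x) :
    mulBilin n x f (of x (Diagram.id n)) = f := by
  induction f using induction with
  | hzero => simp
  | hadd f f' hf hf' => simp [hf, hf']
  | hsmul r f hf => simp [hf]
  | hof a => rw [mulBilin_of, comp_id, loops_id_right, pow_zero, one_smul]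

noncomputable instance : Ring (DiagramAlgebra n F x) where
  __ := (inferInstance : AddCommGroup (DiagramAlgebra n F x))
  mul f g := mulBilin n x f g
  one := of x (Diagram.id n)
  left_distrib f g h := map_add (mulBilin n x f) g h
  right_distrib f g h := LinearMap.map_add₂ (mulBilin n x) f g h
  zero_mul f := LinearMap.map_zero₂ (mulBilin n x) f
  mul_zero f := map_zero (mulBilin n x f)
  mul_assoc := mulBilin_assoc
  one_mul := one_mulBilin
  mul_one := mulBilin_one

noncomputable instance : Algebra F (DiagramAlgebra n F x) :=
  Algebra.ofModule (fun r f g => LinearMap.map_smul₂ (mulBilin n x) r f g)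
    (fun r f g => map_smul (mulBilin n x f) r g)

theorem one_def : (1 : DiagramAlgebra n F x) = of x (Diagram.id n) := rfl

/-- The product of two diagrams. -/
theorem of_mul_of (a b : Diagram n) :
    of x a * of x b = x ^ loops a b • of x (a.comp b) := mulBilin_of a b

end DiagramAlgebra

theorem Diagram.NoHorizontal.id : (Diagram.id n).NoHorizontal :=
  ⟨fun i j h => by simpa using h.1, fun i j h => by simpa using h.1⟩

theorem Diagram.NoHorizontal.comp {a b : Diagram n} (ha : a.NoHorizontal) (hb : b.NoHorizontal) :
    (a.comp b).NoHorizontal := by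
  constructor
  · rintro i j ⟨hij, h⟩
    have key : ∀ z, (stack a b).Reachable (Sum.inl (Sum.inl i)) z →
        z = Sum.inl (Sum.inl i) ∨
        (∃ k, a.graph.Adj (Sum.inl i) (Sum.inr k) ∧
          (z = Sum.inl (Sum.inr k) ∨ z = Sum.inr (Sum.inl k) ∨
            ∃ m, b.graph.Adj (Sum.inl k) (Sum.inr m) ∧ z = Sum.inr (Sum.inr m))) := by
      intro z hz
      rw [SimpleGraph.reachable_iff_reflTransGen] at hz
      induction hz with
      | refl => exact .inl rfl
      | @tail y z _ hyz ih =>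
        rcases ih with rfl | ⟨k, hk, rfl | rfl | ⟨m, hm, rfl⟩⟩
        · cases hyz with | @upper u v hyz =>
          rcases v with v | v
          · exact (ha.1 _ _ hyz).elim
          · exact .inr ⟨v, hyz, .inl rfl⟩
        · cases hyz with
          | upper hyz => rw [a.unique _ _ _ hyz hk.symm]; exact .inl rfl
          | down => exact .inr ⟨k, hk, .inr (.inl rfl)⟩
        · cases hyz with
          | @lower u v hyz =>
            rcases v with v | v
            · exact (hb.1 _ _ hyz).elim
            · exact .inr ⟨k, hk, .inr (.inr ⟨v, hyz, rfl⟩)⟩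
          | up => exact .inr ⟨k, hk, .inl rfl⟩
        · cases hyz with | lower hyz =>
          rw [b.unique _ _ _ hyz hm.symm]
          exact .inr ⟨k, hk, .inr (.inl rfl)⟩
    rcases key _ h with h | ⟨k, hk, h | h | ⟨m, hm, h⟩⟩ <;> simp_all [outer]
  · rintro i j ⟨hij, h⟩
    have key : ∀ z, (stack a b).Reachable (Sum.inr (Sum.inr i)) z →
        z = Sum.inr (Sum.inr i) ∨
        (∃ k, b.graph.Adj (Sum.inr i) (Sum.inl k) ∧
          (z = Sum.inr (Sum.inl k) ∨ z = Sum.inl (Sum.inr k) ∨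
            ∃ m, a.graph.Adj (Sum.inr k) (Sum.inl m) ∧ z = Sum.inl (Sum.inl m))) := by
      intro z hz
      rw [SimpleGraph.reachable_iff_reflTransGen] at hz
      induction hz with
      | refl => exact .inl rfl
      | @tail y z _ hyz ih =>
        rcases ih with rfl | ⟨k, hk, rfl | rfl | ⟨m, hm, rfl⟩⟩
        · cases hyz with | @lower u v hyz =>
          rcases v with v | v
          · exact .inr ⟨v, hyz, .inl rfl⟩
          · exact (hb.2 _ _ hyz).elim
        · cases hyz with
          | lower hyz => rw [b.unique _ _ _ hyz hk.symm]; exact .inl rfl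
          | up => exact .inr ⟨k, hk, .inr (.inl rfl)⟩
        · cases hyz with
          | @upper u v hyz =>
            rcases v with v | v
            · exact .inr ⟨k, hk, .inr (.inr ⟨v, hyz, rfl⟩)⟩
            · exact (ha.2 _ _ hyz).elim
          | down => exact .inr ⟨k, hk, .inl rfl⟩
        · cases hyz with | upper hyz =>
          rw [a.unique _ _ _ hyz hm.symm]
          exact .inr ⟨k, hk, .inr (.inl rfl)⟩
    rcases key _ h with h | ⟨k, hk, h | h | ⟨m, hm, h⟩⟩ <;> simp_all [outer]

/-- The subalgebra `𝕃_n(x)` of `𝔸_n(x)`: the span of the diagrams without horizontal arcs. -/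
noncomputable def noHorizontalSubalgebra (n : ℕ) (F : Type*) [Field F] (x : F) :
    Subalgebra F (DiagramAlgebra n F x) :=
  (Submodule.span F (DiagramAlgebra.of x '' {a : Diagram n | a.NoHorizontal})).toSubalgebra
    (Submodule.subset_span ⟨Diagram.id n, Diagram.NoHorizontal.id, rfl⟩)
    (by
      intro f g hf hg
      induction hf using Submodule.span_induction with
      | zero => simp
      | add f f' _ _ hf hf' => rw [add_mul]; exact add_mem hf hf'
      | smul r f _ hf => rw [smul_mul_assoc]; exact Submodule.smul_mem _ r hf
      | mem f hf =>
        obtain ⟨a, ha, rfl⟩ := hf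
        induction hg using Submodule.span_induction with
        | zero => simp
        | add g g' _ _ hg hg' => rw [mul_add]; exact add_mem hg hg'
        | smul r g _ hg => rw [mul_smul_comm]; exact Submodule.smul_mem _ r hg
        | mem g hg =>
          obtain ⟨b, hb, rfl⟩ := hg
          rw [DiagramAlgebra.of_mul_of]
          exact Submodule.smul_mem _ _ (Submodule.subset_span ⟨_, ha.comp hb, rfl⟩))

/-- An `F`-algebra is semisimple, in the split sense, if it is isomorphic to a finite direct sum
of full matrix algebras over `F`. -/
def IsSplitSemisimple (F A : Type*) [Field F] [Ring A] [Algebra F A] : Prop :=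
  ∃ (k : ℕ) (d : Fin k → ℕ), (∀ i, 0 < d i) ∧
    Nonempty (A ≃ₐ[F] Π i, Matrix (Fin (d i)) (Fin (d i)) F)

end LoopBrauer

open Polynomial Equiv

/-! A diagram without horizontal arcs is a partial injection from the top row to the bottom row, and
`Diagram.comp` composes these partial injections (`Diagram.NoHorizontal.comp_rel`). Let d(a) be the
number of unjoined top vertices. Then ℓ(a, b) = d(a) + d(b) - d(ab)
(`Diagram.NoHorizontal.loops_add_defect`), so the parameter is only a coboundary: for x ≠ 0 the
rescaled diagrams x^(-d(a)) a multiply like the rook monoid.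

The rook monoid algebra is decomposed by Solomon's method. For k-subsets T and U of the rows, record
the bijection that a induces between T and U, if there is one. This gives one matrix over the group
algebra F[S_k] for each k ≤ n, and it is multiplicative because a bijection induced by ab factors
through exactly one intermediate subset (`Diagram.NoHorizontal.entry_comp`). The map is triangular
in k with leading coefficients x^(d(a)) ≠ 0, hence onto (`single_mem_range`), and a dimension count
makes it an isomorphism.

It remains that F[S_k] splits over every field of characteristic zero. Maschke and Wedderburn–Artin
reduce this to scalar endomorphisms of simple modules, proved without Young diagrams by adding one
point j to T at a time. The Jucys–Murphy element is killed by a split polynomial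
(`jucysMurphy_split`), so a simple module for the larger group contains a simple module W of the
smaller group on which this element is a scalar. The averages over the smaller group of elements of
the larger group algebra then act on W by scalars (`sumConj_scalar`), and so does every endomorphism
(`scalar_of_average`). -/

theorem SemiconjBy.aeval_right {R A : Type*} [CommSemiring R] [Semiring A] [Algebra R A]
    {t x y : A} (h : SemiconjBy t x y) (p : R[X]) :
    SemiconjBy t (Polynomial.aeval x p) (Polynomial.aeval y p) := by
  induction p using Polynomial.induction_on' with
  | add p q hp hq => simpa using hp.add_right hq
  | monomial k r =>
    rw [Polynomial.aeval_monomial, Polynomial.aeval_monomial]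
    exact SemiconjBy.mul_right (Algebra.commutes r t).symm (h.pow_right k)

/-! ### Split polynomials and the degenerate affine Hecke relation -/

/-- The split polynomial with the given multiset of roots. -/
noncomputable def rootPoly {F : Type*} [Field F] (M : Multiset F) : F[X] :=
  (M.map fun a => X - C a).prod

/-- The relations are those of the degenerate affine Hecke algebra. Heuristically, an eigenvalue a
of y leads for x to a itself, through the intertwiner `t`, or to a ± 1, where `t` degenerates. No
diagonalisability is needed, only a product of linear factors that vanishes. -/
theorem exists_rootPoly_of_hecke {F A : Type*} [Field F] [Ring A] [Algebra F A] {s x y : A}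
    (hs : s * s = 1) (hx : x = s * y * s + s) (hxy : x * y = y * x)
    (hy : ∃ M : Multiset F, aeval y (rootPoly M) = 0) :
    ∃ M : Multiset F, aeval x (rootPoly M) = 0 := by
  obtain ⟨M, hM⟩ := hy
  have hxs : x * s = s * y + 1 := by
    rw [hx, add_mul, mul_assoc, hs, mul_one]
  have hsx : s * x = y * s + 1 := by
    rw [hx, mul_add, ← mul_assoc, ← mul_assoc, hs, one_mul]
  -- The intertwiner satisfies t x = y t and t² = 1 - (x - y)².
  set t := s * (x - y) - 1 with ht
  have htx : SemiconjBy t x y := by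
    have h1 : y * s = s * x - 1 := by rw [hsx]; abel
    have h2 : y * t = y * s * (x - y) - y := by rw [ht]; noncomm_ring
    rw [SemiconjBy, h2, h1, ht, sub_mul, sub_mul, mul_assoc, mul_assoc, sub_mul, mul_sub x, hxy]
    noncomm_ring
  have htt : t * t = 1 - (x - y) * (x - y) := by
    have h1 : s * (x - y) * s = y - x + 2 * s := by
      have h2 : s * x * s = y + s := by rw [hsx, add_mul, mul_assoc, hs, mul_one, one_mul]
      have h3 : s * y * s = x - s := by rw [hx]; abel
      rw [mul_sub, sub_mul, h2, h3, two_mul]; abel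
    have : t * t = s * (x - y) * s * (x - y) - 2 * (s * (x - y)) + 1 := by
      rw [ht]; noncomm_ring
    rw [this, h1]; noncomm_ring
  set r := aeval x (rootPoly M)
  -- With p = `rootPoly M` and r = p(x), one has t r = p(y) t = 0, hence t² r = 0.
  have hr : ((x - y) * (x - y) - 1) * r = 0 := by
    have h1 : t * r = 0 := by
      rw [(htx.aeval_right (rootPoly M)).eq, hM, zero_mul]
    have h2 : t * t * r = 0 := by rw [mul_assoc, h1, mul_zero]
    rw [htt] at h2
    rw [← neg_sub, neg_mul, h2, neg_zero]
  -- On multiples of r the relation (x - y)² = 1 holds, so (x - a)² - 1 becomes (y - a)(2x - y - a).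
  -- Thus the factors at a + 1 and a - 1 together produce the factor y - a. For N = M all these
  -- factors multiply to p(y) = 0.
  have key : ∀ N : Multiset F, ∃ z, Commute z x ∧ Commute z y ∧
      aeval x (rootPoly (N.map (· + 1)) * rootPoly (N.map (· - 1))) * r =
        aeval y (rootPoly N) * z * r := by
    intro N
    induction N using Multiset.induction with
    | empty => exact ⟨1, .one_left _, .one_left _, by simp [rootPoly]⟩
    | cons a N ih =>
      obtain ⟨z, hzx, hzy, h⟩ := ih
      have hxy' : Commute x y := hxy
      set c := algebraMap F A a
      have hcx : ∀ u, Commute c u := Algebra.commutes a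
      refine ⟨z * (x + x - y - c), ?_, ?_, ?_⟩
      · exact hzx.mul_left (((Commute.add_left rfl rfl).sub_left hxy'.symm).sub_left (hcx x))
      · exact hzy.mul_left (((hxy'.add_left hxy').sub_left rfl).sub_left (hcx y))
      · have h1 : aeval x (rootPoly ((a ::ₘ N).map (· + 1)) * rootPoly ((a ::ₘ N).map (· - 1))) =
            ((x - c) * (x - c) - 1) *
              aeval x (rootPoly (N.map (· + 1)) * rootPoly (N.map (· - 1))) := by
          have : rootPoly ((a ::ₘ N).map (· + 1)) * rootPoly ((a ::ₘ N).map (· - 1)) =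
            ((X - C a) * (X - C a) - 1) * (rootPoly (N.map (· + 1)) * rootPoly (N.map (· - 1))) := by
            simp [rootPoly]; ring
          rw [this]; simp [c]
        have h2 : aeval y (rootPoly (a ::ₘ N)) = aeval y (rootPoly N) * (y - c) := by
          simp [rootPoly, c, mul_comm (X - C a)]
        have hP : Commute (aeval y (rootPoly N)) x :=
          (show SemiconjBy x y y from hxy').aeval_right _ |>.symm
        have hk : ∀ u, Commute u x → Commute u ((x - c) * (x - c) - 1) := fun u hu =>
          have := hu.sub_right (hcx u).symm
          (this.mul_right this).sub_right (.one_right u)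
        have h3 : ((x - c) * (x - c) - 1) * r = (y - c) * (x + x - y - c) * r := by
          have : (x - c) * (x - c) - 1 - (y - c) * (x + x - y - c) = (x - y) * (x - y) - 1 := by
            have e1 := hxy'.eq
            have e2 := (hcx x).eq
            have e3 := (hcx y).eq
            simp only [mul_sub, sub_mul, mul_add, e1, e2, e3]
            abel
          rw [← sub_eq_zero, ← sub_mul, this, hr]
        rw [h1, h2, mul_assoc, h, ← mul_assoc, ← mul_assoc, ((hk _ hP).eq).symm, mul_assoc,
          mul_assoc, ← mul_assoc _ z r, ← (hk _ hzx).eq, mul_assoc z, h3]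
        have : z * (y - c) = (y - c) * z := (hzy.sub_right (hcx z).symm).eq
        simp only [← mul_assoc]
        rw [mul_assoc _ z (y - c), this]
        simp only [← mul_assoc]
  obtain ⟨z, -, -, h⟩ := key M
  rw [hM, zero_mul, zero_mul] at h
  refine ⟨M.map (· + 1) + M.map (· - 1) + M, ?_⟩
  rw [← h]
  simp [rootPoly, r]

/-! ### Scalar endomorphisms of simple modules -/

section SplitsOn

variable {F A : Type*} [Field F] [Ring A] [Algebra F A]

/-- Every simple `B`-submodule of `V` has only scalar endomorphisms. -/
def SplitsOn (B : Subalgebra F A) (V : Type*) [AddCommGroup V] [Module F V] [Module A V]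
    [IsScalarTower F A V] : Prop :=
  ∀ W : Submodule B V, IsSimpleModule B W → ∀ f : Module.End B W, ∃ c : F, ∀ w, f w = c • w

variable {V : Type*} [AddCommGroup V] [Module F V] [Module A V] [IsScalarTower F A V]

omit [Module F V] [IsScalarTower F A V] in
theorem Submodule.subalgebra_smul_mem {B : Subalgebra F A} (W : Submodule B V) {a : A} (ha : a ∈ B)
    {w : V} (hw : w ∈ W) : a • w ∈ W :=
  W.smul_mem (⟨a, ha⟩ : B) hw

/-- On a simple module with scalar endomorphisms the algebra induces every linear map. -/
theorem SplitsOn.exists_smul_eq {B : Subalgebra F A} (hB : SplitsOn B V) (W : Submodule B V)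
    [hW : IsSimpleModule B W] [Module.Finite F W] (g : W →ₗ[F] W) :
    ∃ b : B, ∀ w : W, g w = b • w := by
  -- Since the B-endomorphisms of W are scalars, every F-linear map lies in the bicommutant. The
  -- density theorem then matches it by an element of B on a finite spanning set.
  let f : Module.End (Module.End B W) W :=
    { toFun := g
      map_add' := map_add g
      map_smul' := fun φ w => by
        obtain ⟨c, hc⟩ := hB W hW φ
        simp [hc] }
  obtain ⟨s, hs⟩ := Module.Finite.fg_top (R := F) (M := W)
  obtain ⟨b, hb⟩ := jacobson_density f s
  refine ⟨b, fun w => ?_⟩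
  induction hs.ge (trivial : w ∈ ⊤) using Submodule.span_induction with
  | mem m hm => exact hb m hm
  | zero => simp
  | add x y _ _ h₁ h₂ => rw [map_add, h₁, h₂, smul_add]
  | smul c x _ h => rw [map_smul, h, smul_comm]

/-- On W the endomorphism f agrees with the action of some a' in B'. The elements of B commute with
f, so each u i * a' * v i also acts on W as f. Their sum is therefore |ι| • f on W and a scalar by
`hE`; dividing by |ι| and using that a nonzero vector of W generates V' finishes. -/
theorem scalar_of_average {B B' : Subalgebra F A} (hBB' : B ≤ B') (hB : SplitsOn B V)
    [CharZero F] {ι : Type*} [Fintype ι] [Nonempty ι] {u v : ι → A} (hu : ∀ i, u i ∈ B)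
    (hv : ∀ i, v i ∈ B) (huv : ∀ i, u i * v i = 1)
    (V' : Submodule B' V) [hV' : IsSimpleModule B' V'] (W : Submodule B V) [hW : IsSimpleModule B W]
    [Module.Finite F W] (hWV : ∀ w ∈ W, w ∈ V')
    (hE : ∀ a ∈ B', ∃ c : F, ∀ w ∈ W, (∑ i, u i * a * v i) • w = c • w)
    (f : Module.End B' V') : ∃ c : F, ∀ w, f w = c • w := by
  classical
  let e : W → V' := fun w => ⟨w, hWV w w.2⟩
  have he : ∀ (b : B) (w : W), e (b • w) = (⟨b, hBB' b.2⟩ : B') • e w := fun b w => rfl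
  have hnt : Nontrivial W := hW.nontrivial
  let bs := Module.Free.chooseBasis F W
  have : Nonempty (Module.Free.ChooseBasisIndex F W) := bs.index_nonempty
  let k0 := Classical.arbitrary (Module.Free.ChooseBasisIndex F W)
  have he0 : e (bs k0) ≠ 0 := fun h =>
    bs.ne_zero k0 (Subtype.ext (show ((bs k0 : W) : V) = 0 from congrArg (fun z : V' => (z : V)) h))
  obtain ⟨a, ha⟩ := IsSimpleModule.toSpanSingleton_surjective B' he0 (f (e (bs k0)))
  have ha : a • e (bs k0) = f (e (bs k0)) := ha
  -- Matrix units: p k sends the k-th basis vector to the vector at k0 and the others to 0, and q k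
  -- sends the vector at k0 back to the k-th one.
  have hb1 := fun k => hB.exists_smul_eq W (bs.constr F fun l => if l = k then bs k0 else 0)
  have hb2 := fun k => hB.exists_smul_eq W (bs.constr F fun l => if l = k0 then bs k else 0)
  choose p hp using hb1
  choose q hq using hb2
  let j : B → B' := fun b => ⟨b, hBB' b.2⟩
  -- The element a is only known to agree with f at the vector at k0. Transporting each basis vector
  -- there and back spreads the agreement over W, because f commutes with q k.
  let a' : B' := ∑ k, j (q k) * a * j (p k)
  have he_add : ∀ x y, e (x + y) = e x + e y := fun _ _ => rfl
  have he_smul : ∀ (c : F) x, e (c • x) = c • e x := fun _ _ => rfl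
  have ha' : ∀ w : W, a' • e w = f (e w) := by
    intro w
    have hbasis : ∀ l, a' • e (bs l) = f (e (bs l)) := by
      intro l
      have h1 : ∀ k, (j (q k) * a * j (p k)) • e (bs l) = if l = k then f (e (bs l)) else 0 := by
        intro k
        have h2 : j (p k) • e (bs l) = if l = k then e (bs k0) else 0 := by
          have := hp k (bs l)
          rw [Module.Basis.constr_basis] at this
          rw [← he, ← this]
          split_ifs <;> rfl
        rw [mul_smul, h2, mul_smul]
        split_ifs with h
        · have := hq k (bs k0)
          rw [Module.Basis.constr_basis, if_pos rfl] at this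
          rw [ha, ← map_smul, ← he, ← this, h]
        · simp
      simp only [a', Finset.sum_smul, h1]
      simp
    let f1 : W →ₗ[F] V' :=
      { toFun := fun w => a' • e w
        map_add' := fun x y => by rw [he_add, smul_add]
        map_smul' := fun c x => by rw [he_smul, smul_comm]; rfl }
    let f2 : W →ₗ[F] V' :=
      { toFun := fun w => f (e w)
        map_add' := fun x y => by rw [he_add, map_add]
        map_smul' := fun c x => by
          rw [he_smul, ← algebraMap_smul B' c (e x), map_smul, algebraMap_smul]; rfl }
    exact congr($(bs.ext (f₁ := f1) (f₂ := f2) hbasis) w)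
  obtain ⟨c, hc⟩ := hE a' a'.2
  have key : ∀ w : W, (Fintype.card ι : F) • f (e w) = c • e w := by
    intro w
    have h1 : c • e w = ∑ i, (⟨u i, hBB' (hu i)⟩ * a' * ⟨v i, hBB' (hv i)⟩ : B') • e w := by
      apply Subtype.ext
      rw [← Finset.sum_smul]
      refine (hc w w.2).symm.trans ?_
      simp [Subalgebra.smul_def, e]
    rw [h1]
    have h2 : ∀ i, (⟨u i, hBB' (hu i)⟩ * a' * ⟨v i, hBB' (hv i)⟩ : B') • e w = f (e w) := by
      intro i
      have h3 := ha' ((⟨v i, hv i⟩ : B) • w)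
      rw [he] at h3
      rw [mul_smul, mul_smul, h3, ← map_smul, smul_smul]
      have : (⟨u i, hBB' (hu i)⟩ * ⟨v i, hBB' (hv i)⟩ : B') = 1 := Subtype.ext (huv i)
      rw [this, one_smul]
    simp [h2, Nat.cast_smul_eq_nsmul]
  have hcard : (Fintype.card ι : F) ≠ 0 := by simp
  refine ⟨(Fintype.card ι : F)⁻¹ * c, fun x => ?_⟩
  obtain ⟨b, rfl⟩ := IsSimpleModule.toSpanSingleton_surjective B' he0 x
  have h0 : f (e (bs k0)) = ((Fintype.card ι : F)⁻¹ * c) • e (bs k0) := by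
    rw [mul_smul, ← key, smul_smul, inv_mul_cancel₀ hcard, one_smul]
  rw [LinearMap.toSpanSingleton_apply, map_smul, h0, smul_comm]

/-- An element that is killed by a split polynomial has an eigenvector in every stable submodule. -/
theorem exists_eigenvector {x : A} {M : Multiset F} (hM : aeval x (rootPoly M) = 0)
    (p : V → Prop) (hp : ∀ (c : F) v, p v → p ((x - algebraMap F A c) • v)) {v : V} (hv : v ≠ 0)
    (hpv : p v) : ∃ (c : F) (w : V), w ≠ 0 ∧ p w ∧ x • w = c • w := by
  have key : ∀ (M : Multiset F) (v : V), v ≠ 0 → p v → aeval x (rootPoly M) • v = 0 →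
      ∃ (c : F) (w : V), w ≠ 0 ∧ p w ∧ x • w = c • w := by
    intro M
    induction M using Multiset.induction with
    | empty => intro v hv _ h; simp [rootPoly, hv] at h
    | cons a M ih =>
      intro v hv hpv h
      by_cases h0 : (x - algebraMap F A a) • v = 0
      · exact ⟨a, v, hv, hpv, by rwa [sub_smul, algebraMap_smul, sub_eq_zero] at h0⟩
      · refine ih _ h0 (hp a v hpv) ?_
        rw [← h, smul_smul]
        congr 1
        simp [rootPoly, mul_comm (X - C a)]
  exact key M v hv hpv (by rw [hM, zero_smul])

end SplitsOn

/-! ### Group algebras of subsets of points and Jucys–Murphy elements -/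

section SymmetricGroup

set_option linter.unusedSectionVars false

variable {α : Type*} [DecidableEq α] (F : Type*) [Field F]

/-- The permutations that fix every point outside `T`. -/
def permsOn (T : Finset α) : Subgroup (Perm α) where
  carrier := {g | ∀ i ∉ T, g i = i}
  mul_mem' := fun {g h} hg hh i hi => by rw [Perm.mul_apply, hh i hi, hg i hi]
  one_mem' := fun _ _ => rfl
  inv_mem' := fun {g} hg i hi => by rw [Perm.inv_eq_iff_eq, hg i hi]

theorem permsOn.apply_mem {T : Finset α} {g : Perm α} (hg : g ∈ permsOn T) {i : α} (hi : i ∈ T) :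
    g i ∈ T := by
  by_contra h
  rw [g.injective (hg _ h)] at h
  exact h hi

theorem swap_mem_permsOn {T : Finset α} {i j : α} (hi : i ∈ T) (hj : j ∈ T) :
    swap i j ∈ permsOn T := fun k hk =>
  swap_apply_of_ne_of_ne (by rintro rfl; exact hk hi) (by rintro rfl; exact hk hj)

theorem permsOn_mono {T T' : Finset α} (h : T ⊆ T') : permsOn T ≤ permsOn T' :=
  fun _ hg i hi => hg i fun hi' => hi (h hi')

/-- The group algebra of the permutations that fix every point outside `T`. -/
noncomputable def permsAlgebra (T : Finset α) : Subalgebra F (MonoidAlgebra F (Perm α)) :=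
  Algebra.adjoin F ((permsOn T).toSubmonoid.map (MonoidAlgebra.of F (Perm α)))

variable {F}

theorem of_mem_permsAlgebra {T : Finset α} {g : Perm α} (hg : g ∈ permsOn T) :
    MonoidAlgebra.of F _ g ∈ permsAlgebra F T :=
  Algebra.subset_adjoin ⟨g, hg, rfl⟩

theorem permsAlgebra_mono {T T' : Finset α} (h : T ⊆ T') :
    permsAlgebra F T ≤ permsAlgebra F T' :=
  Algebra.adjoin_mono (Set.image_mono (permsOn_mono h))

theorem permsAlgebra_induction {T : Finset α} {p : MonoidAlgebra F (Perm α) → Prop}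
    (hof : ∀ g ∈ permsOn T, p (MonoidAlgebra.of F _ g)) (hzero : p 0)
    (hadd : ∀ a b, p a → p b → p (a + b)) (hsmul : ∀ (c : F) a, p a → p (c • a))
    {a : MonoidAlgebra F (Perm α)} (ha : a ∈ permsAlgebra F T) : p a := by
  rw [permsAlgebra, ← Subalgebra.mem_toSubmodule, Algebra.adjoin_eq_span,
    Submonoid.closure_eq] at ha
  induction ha using Submodule.span_induction with
  | mem a h =>
    obtain ⟨g, hg, rfl⟩ := h
    exact hof g hg
  | zero => exact hzero
  | add a b _ _ ha hb => exact hadd a b ha hb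
  | smul c a _ ha => exact hsmul c a ha

variable (F) in
/-- The Jucys–Murphy element `∑ t ∈ T, (t j)`. -/
noncomputable def jucysMurphy (T : Finset α) (j : α) : MonoidAlgebra F (Perm α) :=
  ∑ t ∈ T, MonoidAlgebra.of F _ (swap t j)

theorem jucysMurphy_mem (T : Finset α) (j : α) :
    jucysMurphy F T j ∈ permsAlgebra F (insert j T) :=
  sum_mem fun _ ht => of_mem_permsAlgebra
    (swap_mem_permsOn (Finset.mem_insert_of_mem ht) (Finset.mem_insert_self _ _))

/-- Conjugation by g fixes j and permutes T, hence permutes the transpositions in the sum. -/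
theorem jucysMurphy_commute_of {T : Finset α} {j : α} (hj : j ∉ T) {g : Perm α}
    (hg : g ∈ permsOn T) : Commute (jucysMurphy F T j) (MonoidAlgebra.of F _ g) := by
  rw [Commute, SemiconjBy, jucysMurphy, Finset.sum_mul, Finset.mul_sum]
  refine Finset.sum_bij' (fun t _ => g⁻¹ t) (fun t _ => g t)
    (fun t ht => permsOn.apply_mem (inv_mem hg) ht) (fun t ht => permsOn.apply_mem hg ht)
    (by simp) (by simp) fun t ht => ?_
  rw [← map_mul, ← map_mul, mul_swap_eq_swap_mul, hg j hj,
    show g (g⁻¹ t) = t from g.apply_symm_apply t]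

theorem jucysMurphy_commute {T : Finset α} {j : α} (hj : j ∉ T) {a : MonoidAlgebra F (Perm α)}
    (ha : a ∈ permsAlgebra F T) : Commute (jucysMurphy F T j) a :=
  permsAlgebra_induction (fun _ hg => jucysMurphy_commute_of hj hg) (.zero_right _)
    (fun _ _ => .add_right) (fun c _ h => h.smul_right c) ha

/-- With s = (i j), conjugating the element for (T, i) by s and adding s gives the element for
(`insert i T`, j). These two commute, so `exists_rootPoly_of_hecke` carries the induction. -/
theorem jucysMurphy_split (T : Finset α) : ∀ j ∉ T,
    ∃ M : Multiset F, aeval (jucysMurphy F T j) (rootPoly M) = 0 := by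
  induction T using Finset.induction_on with
  -- The empty sum is 0, whose only root is 0.
  | empty => exact fun j _ => ⟨{0}, by simp [rootPoly, jucysMurphy]⟩
  | insert i T hi ih =>
    intro j hj
    have hij : i ≠ j := by rintro rfl; simp at hj
    have hjT : j ∉ T := fun h => hj (Finset.mem_insert_of_mem h)
    refine exists_rootPoly_of_hecke (s := MonoidAlgebra.of F _ (swap i j)) (y := jucysMurphy F T i)
      (by rw [← map_mul, swap_mul_self, map_one]) ?_
      (jucysMurphy_commute hj (jucysMurphy_mem T i)).eq (ih i hi)
    rw [jucysMurphy, Finset.sum_insert hi, add_comm, jucysMurphy, Finset.mul_sum, Finset.sum_mul]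
    congr 1
    refine Finset.sum_congr rfl fun t ht => ?_
    rw [← map_mul, ← map_mul]
    congr 1
    have h1 : t ≠ i := by rintro rfl; exact hi ht
    have h2 : t ≠ j := by rintro rfl; exact hjT ht
    have := swap_apply_apply (swap i j) t i
    rw [swap_inv, swap_apply_of_ne_of_ne h1 h2, swap_apply_left] at this
    exact this

variable [Fintype α]

/-! ### Averages over a smaller symmetric group -/

noncomputable instance (T : Finset α) : Fintype (permsOn T) := Fintype.ofFinite _

/-- The sum of the conjugates of `a` by the permutations that fix every point outside `T`. -/
noncomputable def sumConj (T : Finset α) (a : MonoidAlgebra F (Perm α)) :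
    MonoidAlgebra F (Perm α) :=
  ∑ h : permsOn T, MonoidAlgebra.of F _ (h : Perm α) * a * MonoidAlgebra.of F _ (h : Perm α)⁻¹

theorem sumConj_add (T : Finset α) (a b : MonoidAlgebra F (Perm α)) :
    sumConj T (a + b) = sumConj T a + sumConj T b := by
  simp [sumConj, mul_add, add_mul, Finset.sum_add_distrib]

theorem sumConj_smul (T : Finset α) (c : F) (a : MonoidAlgebra F (Perm α)) :
    sumConj T (c • a) = c • sumConj T a := by
  simp [sumConj, Finset.smul_sum]

theorem sumConj_sum (T : Finset α) {ι : Type*} (s : Finset ι) (a : ι → MonoidAlgebra F (Perm α)) :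
    sumConj T (∑ i ∈ s, a i) = ∑ i ∈ s, sumConj T (a i) := by
  simp_rw [sumConj, Finset.mul_sum, Finset.sum_mul]
  exact Finset.sum_comm

theorem sumConj_conj {T : Finset α} {g : Perm α} (hg : g ∈ permsOn T)
    (a : MonoidAlgebra F (Perm α)) :
    sumConj T (MonoidAlgebra.of F _ g * a * MonoidAlgebra.of F _ g⁻¹) = sumConj T a := by
  refine Fintype.sum_equiv (Equiv.mulRight ⟨g, hg⟩) _ _ fun h => ?_
  simp only [Equiv.coe_mulRight, Subgroup.coe_mul, mul_inv_rev, map_mul]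
  noncomm_ring

theorem sumConj_mem {T : Finset α} {g : Perm α} (hg : g ∈ permsOn T) :
    sumConj T (MonoidAlgebra.of F _ g) ∈ permsAlgebra F T :=
  sum_mem fun h _ => mul_mem (mul_mem (of_mem_permsAlgebra h.2) (of_mem_permsAlgebra hg))
    (of_mem_permsAlgebra (inv_mem h.2))

theorem sumConj_commute_of {T : Finset α} {g : Perm α} (hg : g ∈ permsOn T)
    (a : MonoidAlgebra F (Perm α)) : Commute (sumConj T a) (MonoidAlgebra.of F _ g) := by
  rw [Commute, SemiconjBy, sumConj, Finset.sum_mul, Finset.mul_sum]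
  refine Fintype.sum_equiv (Equiv.mulLeft ⟨g⁻¹, inv_mem hg⟩) _ _ fun h => ?_
  simp only [Equiv.coe_mulLeft, Subgroup.coe_mul, mul_inv_rev, map_mul, inv_inv]
  have : MonoidAlgebra.of F (Perm α) g * MonoidAlgebra.of F (Perm α) g⁻¹ = 1 := by
    rw [← map_mul, mul_inv_cancel, map_one]
  rw [← mul_assoc, ← mul_assoc, ← mul_assoc, ← mul_assoc, this, one_mul]

theorem sumConj_commute {T : Finset α} {b : MonoidAlgebra F (Perm α)} (hb : b ∈ permsAlgebra F T)
    (a : MonoidAlgebra F (Perm α)) : Commute (sumConj T a) b :=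
  permsAlgebra_induction (fun _ hg => sumConj_commute_of hg a) (.zero_right _)
    (fun _ _ => .add_right) (fun c _ h => h.smul_right c) hb

theorem sumConj_jucysMurphy_mul {T : Finset α} {j : α} (hj : j ∉ T)
    (a : MonoidAlgebra F (Perm α)) :
    sumConj T (jucysMurphy F T j * a) = jucysMurphy F T j * sumConj T a := by
  rw [sumConj, sumConj, Finset.mul_sum]
  refine Finset.sum_congr rfl fun h _ => ?_
  rw [← mul_assoc, ← (jucysMurphy_commute_of hj h.2).eq, mul_assoc, mul_assoc, mul_assoc]

/-- The points of `T` that are moved by `g`. -/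
def movedIn (T : Finset α) (g : Perm α) : Finset α := T.filter fun t => g t ≠ t

/-- The transposition (s t) commutes with g and conjugates (t j) into (s j), so the two permutations
are conjugate under `permsOn T`. -/
theorem sumConj_swap_mul_eq {T : Finset α} {j : α} (hj : j ∉ T) {g : Perm α} {s t : α} (hs : s ∈ T)
    (ht : t ∈ T) (hgs : g s = s) (hgt : g t = t) :
    sumConj T (MonoidAlgebra.of F _ (swap s j * g)) =
      sumConj T (MonoidAlgebra.of F _ (swap t j * g)) := by
  have hsj : j ≠ s := by rintro rfl; exact hj hs
  have htj : j ≠ t := by rintro rfl; exact hj ht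
  rw [← sumConj_conj (swap_mem_permsOn hs ht) (MonoidAlgebra.of F _ (swap t j * g)),
    ← map_mul, ← map_mul]
  congr 2
  have h1 : g * swap s t = swap s t * g := by
    rw [mul_swap_eq_swap_mul, hgs, hgt]
  have h2 := swap_apply_apply (swap s t) t j
  rw [swap_apply_right, swap_apply_of_ne_of_ne hsj htj] at h2
  rw [h2, swap_inv, mul_assoc, mul_assoc, mul_assoc, mul_assoc, h1]

variable {V : Type*} [AddCommGroup V] [Module F V] [Module (MonoidAlgebra F (Perm α)) V]
  [IsScalarTower F (MonoidAlgebra F (Perm α)) V]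

/-- In effect, the centraliser of F[S_T] in the larger group algebra is generated by the centre of
F[S_T] and the Jucys–Murphy element, both of which act on W by scalars. The induction on the number
of moved points of T extracts the sum of conjugates of g from the product of the Jucys–Murphy
element with a simpler sum. -/
theorem sumConj_of_scalar [CharZero F] {T : Finset α} {j : α} (hj : j ∉ T)
    (hT : SplitsOn (permsAlgebra F T) V) (W : Submodule (permsAlgebra F T) V)
    (hW : IsSimpleModule (permsAlgebra F T) W) {x : F}
    (hx : ∀ w ∈ W, jucysMurphy F T j • w = x • w) (k : ℕ) :
    ∀ g ∈ permsOn (insert j T), (movedIn T g).card = k →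
      ∃ c : F, ∀ w ∈ W, sumConj T (MonoidAlgebra.of F _ g) • w = c • w := by
  induction k using Nat.strong_induction_on with
  | _ k ih =>
  intro g hg hk
  by_cases hgj : g j = j
  · have hg' : g ∈ permsOn T := fun i hi => by
      by_cases h : i = j
      · rw [h, hgj]
      · exact hg i (by simp [h, hi])
    -- If g fixes j, its sum of conjugates is central in the smaller algebra and gives an
    -- endomorphism of W, which is a scalar by `hT`.
    let f : Module.End (permsAlgebra F T) W :=
      { toFun := fun w => ⟨_, W.subalgebra_smul_mem (sumConj_mem (F := F) hg') w.2⟩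
        map_add' := fun u v => Subtype.ext (smul_add _ _ _)
        map_smul' := fun b w => Subtype.ext <| by
          simp only [Submodule.coe_smul, Subalgebra.smul_def, RingHom.id_apply, smul_smul,
            (sumConj_commute b.2 _).eq] }
    obtain ⟨c, hc⟩ := hT W hW f
    exact ⟨c, fun w hw => congrArg Subtype.val (hc ⟨w, hw⟩)⟩
  · set i := g⁻¹ j with hi
    have hgi : g i = j := g.apply_symm_apply j
    have hij : i ≠ j := fun h => hgj (h ▸ hgi)
    have hiT : i ∈ T := by
      have : i ∈ insert j T := permsOn.apply_mem (inv_mem hg) (Finset.mem_insert_self _ _)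
      exact Finset.mem_of_mem_insert_of_ne this hij
    -- Removing the transposition makes i a fixed point and creates no new moved point in T.
    set g' := swap i j * g with hg'
    have hgg' : g = swap i j * g' := by rw [hg', ← mul_assoc, swap_mul_self, one_mul]
    have hT' : T ⊆ insert j T := Finset.subset_insert _ _
    have hsw : ∀ t ∈ T, swap t j ∈ permsOn (insert j T) := fun t ht =>
      swap_mem_permsOn (hT' ht) (Finset.mem_insert_self _ _)
    have hg'm : g' ∈ permsOn (insert j T) := mul_mem (hsw i hiT) hg
    have hg'i : g' i = i := by rw [hg', Perm.mul_apply, hgi, swap_apply_right]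
    have hne : ∀ {t}, t ∈ T → t ≠ j := by rintro t ht rfl; exact hj ht
    have hlt : (movedIn T g').card < k := by
      rw [← hk]
      refine Finset.card_lt_card ((Finset.ssubset_iff_of_subset fun t ht => ?_).2 ⟨i, ?_, ?_⟩)
      · simp only [movedIn, Finset.mem_filter] at ht ⊢
        refine ⟨ht.1, fun h => ht.2 ?_⟩
        have hti : t ≠ i := by rintro rfl; exact hij (h.symm.trans hgi)
        rw [hg', Perm.mul_apply, h, swap_apply_of_ne_of_ne hti (hne ht.1)]
      · simp only [movedIn, Finset.mem_filter]
        exact ⟨hiT, by rw [hgi]; exact hij.symm⟩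
      · simp [movedIn, hg'i]
    obtain ⟨c', hc'⟩ := ih _ hlt g' hg'm rfl
    -- For t already moved by g', multiplying by (t j) moves no further point of T, so the induction
    -- hypothesis still applies.
    have hmoved : ∀ t ∈ movedIn T g', ∃ c : F, ∀ w ∈ W,
        sumConj T (MonoidAlgebra.of F _ (swap t j * g')) • w = c • w := by
      intro t ht
      refine ih _ (lt_of_le_of_lt (Finset.card_le_card fun s hs => ?_) hlt) _
        (mul_mem (hsw t (Finset.mem_filter.1 ht).1) hg'm) rfl
      simp only [movedIn, Finset.mem_filter] at hs ht ⊢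
      refine ⟨hs.1, fun h => hs.2 ?_⟩
      have hst : s ≠ t := by rintro rfl; exact ht.2 h
      rw [Perm.mul_apply, h, swap_apply_of_ne_of_ne hst (hne hs.1)]
    choose! d hd using hmoved
    -- The points t of T fixed by g' all give the same term as i, namely the sum of conjugates of g.
    have hsum : jucysMurphy F T j * sumConj T (MonoidAlgebra.of F _ g') =
        ∑ t ∈ movedIn T g', sumConj T (MonoidAlgebra.of F _ (swap t j * g')) +
          ((T.filter fun t => ¬ g' t ≠ t).card : F) • sumConj T (MonoidAlgebra.of F _ g) := by
      rw [← sumConj_jucysMurphy_mul hj, jucysMurphy, Finset.sum_mul, sumConj_sum,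
        ← Finset.sum_filter_add_sum_filter_not T fun t => g' t ≠ t]
      simp_rw [← map_mul]
      congr 1
      rw [Nat.cast_smul_eq_nsmul, ← Finset.sum_const]
      refine Finset.sum_congr rfl fun t ht => ?_
      rw [Finset.mem_filter, not_not] at ht
      rw [sumConj_swap_mul_eq hj ht.1 hiT ht.2 hg'i, ← hgg']
    set m : F := ((T.filter fun t => ¬ g' t ≠ t).card : F) with hm
    -- The count is positive because i is fixed by g'; characteristic zero then allows division.
    have hm0 : m ≠ 0 := by
      rw [hm, Nat.cast_ne_zero, Finset.card_ne_zero]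
      exact ⟨i, by simp [hiT, hg'i]⟩
    refine ⟨m⁻¹ * (x * c' - ∑ t ∈ movedIn T g', d t), fun w hw => ?_⟩
    have h1 := congrArg (· • w) hsum
    simp only [add_smul, mul_smul, Finset.sum_smul, smul_assoc, hc' w hw] at h1
    rw [Finset.sum_congr rfl fun t ht => hd t ht w hw, smul_comm, hx w hw, ← Finset.sum_smul,
      ← sub_eq_iff_eq_add'] at h1
    rw [mul_smul, sub_smul, mul_comm x, mul_smul, h1, smul_smul, inv_mul_cancel₀ hm0, one_smul]

theorem sumConj_scalar [CharZero F] {T : Finset α} {j : α} (hj : j ∉ T)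
    (hT : SplitsOn (permsAlgebra F T) V) (W : Submodule (permsAlgebra F T) V)
    (hW : IsSimpleModule (permsAlgebra F T) W) {x : F}
    (hx : ∀ w ∈ W, jucysMurphy F T j • w = x • w) {a : MonoidAlgebra F (Perm α)}
    (ha : a ∈ permsAlgebra F (insert j T)) : ∃ c : F, ∀ w ∈ W, sumConj T a • w = c • w := by
  refine permsAlgebra_induction
    (p := fun a => ∃ c : F, ∀ w ∈ W, sumConj T a • w = c • w)
    (fun g hg => sumConj_of_scalar hj hT W hW hx _ g hg rfl)
    ⟨0, by simp [sumConj]⟩ (fun a b ⟨c, hc⟩ ⟨d, hd⟩ => ⟨c + d, fun w hw => ?_⟩)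
    (fun c a ⟨d, hd⟩ => ⟨c * d, fun w hw => ?_⟩) ha
  · rw [sumConj_add, add_smul, add_smul, hc w hw, hd w hw]
  · rw [sumConj_smul, smul_assoc, hd w hw, mul_smul]

/-- For empty T the algebra is F and a simple module is a line. Adding a point j combines an
eigenvector of the Jucys–Murphy element with `sumConj_scalar` and `scalar_of_average`. -/
theorem splitsOn_permsAlgebra [CharZero F] [Module.Finite F V] (T : Finset α) :
    SplitsOn (permsAlgebra F T) V := by
  induction T using Finset.induction_on with
  | empty =>
    intro W hW f
    have hscalar : ∀ b : permsAlgebra F (∅ : Finset α), ∃ c : F,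
        (b : MonoidAlgebra F (Perm α)) = algebraMap F _ c := by
      intro b
      refine permsAlgebra_induction (p := fun a => ∃ c : F, a = algebraMap F _ c)
        (fun g hg => ⟨1, ?_⟩) ⟨0, by simp⟩ ?_ ?_ b.2
      · have : g = 1 := Equiv.ext fun i => hg i (by simp)
        rw [this, map_one, map_one]
      · rintro a b ⟨c, rfl⟩ ⟨d, rfl⟩
        exact ⟨c + d, by rw [map_add]⟩
      · rintro c a ⟨d, rfl⟩
        exact ⟨c * d, by rw [map_mul, Algebra.smul_def]⟩
    have := hW.nontrivial
    obtain ⟨w0, hw0⟩ := exists_ne (0 : W)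
    have hs := IsSimpleModule.toSpanSingleton_surjective (permsAlgebra F (∅ : Finset α)) (M := W) hw0
    have hs' : ∀ w : W, ∃ c : F, w = c • w0 := by
      intro w
      obtain ⟨b, rfl⟩ := hs w
      obtain ⟨c, hc⟩ := hscalar b
      refine ⟨c, Subtype.ext ?_⟩
      rw [LinearMap.toSpanSingleton_apply, Submodule.coe_smul, Subalgebra.smul_def, hc,
        algebraMap_smul]
      rfl
    obtain ⟨c, hc⟩ := hs' (f w0)
    refine ⟨c, fun w => ?_⟩
    obtain ⟨d, rfl⟩ := hs' w
    rw [← algebraMap_smul (permsAlgebra F (∅ : Finset α)) d w0, map_smul, algebraMap_smul, hc,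
      algebraMap_smul, smul_comm]
  | insert j T hj ih =>
    intro V' hV' f
    have hle : permsAlgebra F T ≤ permsAlgebra F (insert j T) :=
      permsAlgebra_mono (Finset.subset_insert j T)
    have hV'nt := hV'.nontrivial
    obtain ⟨v0, hv0⟩ := exists_ne (0 : V')
    obtain ⟨M, hM⟩ := jucysMurphy_split (F := F) T j hj
    obtain ⟨x, v, hv, hvV, hxv⟩ := exists_eigenvector hM (fun v : V => v ∈ V')
      (fun c v hv => V'.subalgebra_smul_mem (sub_mem (jucysMurphy_mem T j)
        (Subalgebra.algebraMap_mem _ c)) hv) (fun h => hv0 (Subtype.ext h)) v0.2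
    -- The eigenspace is stable under the smaller algebra because that algebra commutes with the
    -- Jucys–Murphy element.
    let K : Submodule (permsAlgebra F T) V :=
      { carrier := {v | v ∈ V' ∧ jucysMurphy F T j • v = x • v}
        add_mem' := fun ha hb => ⟨add_mem ha.1 hb.1, by rw [smul_add, ha.2, hb.2, smul_add]⟩
        zero_mem' := ⟨zero_mem _, by simp⟩
        smul_mem' := fun b v hv => ⟨V'.subalgebra_smul_mem (hle b.2) hv.1, by
          rw [Subalgebra.smul_def, smul_smul, (jucysMurphy_commute hj b.2).eq, mul_smul, hv.2,
            smul_comm]⟩ }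
    -- Finite dimension provides a minimal nonzero submodule W inside the nonzero eigenspace.
    have : IsArtinian (permsAlgebra F T) V := isArtinian_of_tower F inferInstance
    obtain h | ⟨W, hW, hWK⟩ := IsAtomic.eq_bot_or_exists_atom_le K
    · have : v ∈ K := ⟨hvV, hxv⟩
      rw [h, Submodule.mem_bot] at this
      exact absurd this hv
    have hW := isSimpleModule_iff_isAtom.2 hW
    have : Module.Finite F W :=
      Module.Finite.of_injective (W.subtype.restrictScalars F) Subtype.val_injective
    exact scalar_of_average (u := fun h : permsOn T => MonoidAlgebra.of F _ (h : Perm α))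
      (v := fun h : permsOn T => MonoidAlgebra.of F _ (h : Perm α)⁻¹) hle ih
      (fun h => of_mem_permsAlgebra h.2) (fun h => of_mem_permsAlgebra (inv_mem h.2))
      (fun h => by rw [← map_mul, mul_inv_cancel, map_one]) V' W (fun w hw => (hWK hw).1)
      (fun a ha => sumConj_scalar hj ih W hW (fun w hw => (hWK hw).2) ha) f

end SymmetricGroup

namespace LoopBrauer

/-! ### Split semisimplicity of the group algebras of symmetric groups -/

section Split

variable {F : Type*} [Field F]

theorem IsSplitSemisimple.of_pi_matrix {A : Type*} [Ring A] [Algebra F A] {J : Type*} [Finite J]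
    {m : J → Type*} [∀ j, Fintype (m j)] [∀ j, DecidableEq (m j)] [∀ j, Nonempty (m j)]
    (e : A ≃ₐ[F] Π j, Matrix (m j) (m j) F) : IsSplitSemisimple F A := by
  obtain ⟨k, ⟨φ⟩⟩ := Finite.exists_equiv_fin J
  refine ⟨k, fun i => Fintype.card (m (φ.symm i)), fun i => Fintype.card_pos, ⟨?_⟩⟩
  exact (e.trans (AlgEquiv.piCongrLeft' F (fun j => Matrix (m j) (m j) F) φ)).trans
    (AlgEquiv.piCongrRight fun i => Matrix.reindexAlgEquiv F F (Fintype.equivFin _))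

/-- Matrices over a product are a product of matrix algebras, and matrices over matrices are block
matrices. -/
theorem IsSplitSemisimple.of_pi_matrix_of_split {A : Type*} [Ring A] [Algebra F A]
    {J : Type*} [Finite J] {m : J → Type*} [∀ j, Fintype (m j)] [∀ j, DecidableEq (m j)]
    [∀ j, Nonempty (m j)] {R : J → Type*} [∀ j, Ring (R j)] [∀ j, Algebra F (R j)] (hR : ∀ j, IsSplitSemisimple F (R j))
    (e : A ≃ₐ[F] Π j, Matrix (m j) (m j) (R j)) : IsSplitSemisimple F A := by
  choose k d hd E using hR
  have : ∀ j i, Nonempty (Fin (d j i)) := fun j i => ⟨⟨0, hd j i⟩⟩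
  let c : (Π j, Π i : Fin (k j), Matrix (m j × Fin (d j i)) (m j × Fin (d j i)) F) ≃ₐ[F]
      Π q : (Σ j, Fin (k j)), Matrix (m q.1 × Fin (d q.1 q.2)) (m q.1 × Fin (d q.1 q.2)) F :=
    { toFun := fun f q => f q.1 q.2
      invFun := fun f j i => f ⟨j, i⟩
      left_inv := fun _ => rfl
      right_inv := fun _ => rfl
      map_mul' := fun _ _ => rfl
      map_add' := fun _ _ => rfl
      commutes' := fun _ => rfl }
  refine IsSplitSemisimple.of_pi_matrix
    (e.trans (AlgEquiv.trans (AlgEquiv.piCongrRight fun j => ?_) c))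
  exact ((E j).some.mapMatrix.trans (Matrix.piAlgEquiv F)).trans
    (AlgEquiv.piCongrRight fun i => Matrix.compAlgEquiv _ _ _ _)

theorem endomorphism_scalar [CharZero F] {α : Type*} [Fintype α] {V : Type*} [AddCommGroup V]
    [Module F V] [Module (MonoidAlgebra F (Perm α)) V]
    [IsScalarTower F (MonoidAlgebra F (Perm α)) V] [Module.Finite F V]
    (S : Submodule (MonoidAlgebra F (Perm α)) V) [IsSimpleModule (MonoidAlgebra F (Perm α)) S]
    (f : Module.End (MonoidAlgebra F (Perm α)) S) : ∃ c : F, ∀ w, f w = c • w := by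
  classical
  let B := permsAlgebra F (Finset.univ : Finset α)
  have hB : ∀ a, a ∈ B := fun a => by
    induction a using MonoidAlgebra.induction_on with
    | of g => exact of_mem_permsAlgebra fun i hi => (hi (Finset.mem_univ i)).elim
    | add a b ha hb => exact add_mem ha hb
    | smul c a ha => exact Subalgebra.smul_mem _ ha c
  -- For T the set of all points, the subalgebra is the whole group algebra; W is S with its scalars
  -- transported along this identification.
  let W : Submodule B V :=
    { S with smul_mem' := fun b v hv => S.smul_mem (b : MonoidAlgebra F (Perm α)) hv }
  have : RingHomSurjective (B.val : B →+* MonoidAlgebra F (Perm α)) :=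
    ⟨fun a => ⟨⟨a, hB a⟩, rfl⟩⟩
  let l : W →ₛₗ[(B.val : B →+* MonoidAlgebra F (Perm α))] S :=
    { toFun := fun w => ⟨w, w.2⟩
      map_add' := fun _ _ => rfl
      map_smul' := fun _ _ => rfl }
  have hW : IsSimpleModule B W :=
    (LinearMap.isSimpleModule_iff_of_bijective l ⟨fun _ _ h => Subtype.ext (congrArg Subtype.val h),
      fun s => ⟨⟨s, s.2⟩, rfl⟩⟩).2 inferInstance
  obtain ⟨c, hc⟩ := splitsOn_permsAlgebra (F := F) (V := V) Finset.univ W hW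
    { toFun := fun w => ⟨f ⟨w, w.2⟩, (f ⟨w, w.2⟩).2⟩
      map_add' := fun u v => Subtype.ext (congrArg Subtype.val (map_add f ⟨u, u.2⟩ ⟨v, v.2⟩))
      map_smul' := fun b v => Subtype.ext
        (congrArg Subtype.val (map_smul f (b : MonoidAlgebra F (Perm α)) ⟨v, v.2⟩)) }
  exact ⟨c, fun w => Subtype.ext (congrArg Subtype.val (hc ⟨w, w.2⟩))⟩

/-- In characteristic zero every field is a splitting field of the symmetric groups. -/
theorem isSplitSemisimple_monoidAlgebra_perm [CharZero F] (α : Type*) [Finite α] :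
    IsSplitSemisimple F (MonoidAlgebra F (Perm α)) := by
  have := Fintype.ofFinite α
  have : NeZero (Nat.card (Perm α) : F) := ⟨Nat.cast_ne_zero.2 Nat.card_pos.ne'⟩
  obtain ⟨k, S, d, hS, hd, ⟨e⟩⟩ := IsSemisimpleRing.exists_algEquiv_pi_matrix_end_mulOpposite F
    (MonoidAlgebra F (Perm α))
  -- Wedderburn–Artin yields matrices over the opposite endomorphism rings of simple submodules;
  -- scalar endomorphisms identify each of these rings with F.
  refine ⟨k, d, fun i => Nat.pos_of_neZero _, ⟨e.trans (AlgEquiv.piCongrRight fun i =>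
    (AlgEquiv.ofBijective (Algebra.ofId F _) ⟨?_, fun f => ?_⟩).symm.mapMatrix)⟩⟩
  · have := (hS i).nontrivial
    exact (algebraMap F _).injective
  · obtain ⟨c, hc⟩ := endomorphism_scalar (S i) f.unop
    refine ⟨c, MulOpposite.unop_injective (LinearMap.ext fun w => ?_)⟩
    rw [hc]
    rfl

end Split

/-! ### Diagrams without horizontal arcs as partial injections -/

section Rel

variable {n : ℕ}

/-- The top vertex `i` is joined to the bottom vertex `j`. -/
def Diagram.Rel (a : Diagram n) (i j : Fin n) : Prop := a.graph.Adj (Sum.inl i) (Sum.inr j)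

theorem Diagram.Rel.right_unique {a : Diagram n} {i j k : Fin n} (h : a.Rel i j) (h' : a.Rel i k) :
    j = k := Sum.inr_injective (a.unique _ _ _ h h')

theorem Diagram.Rel.left_unique {a : Diagram n} {i j k : Fin n} (h : a.Rel i k) (h' : a.Rel j k) :
    i = j := Sum.inl_injective (a.unique _ _ _ h.symm h'.symm)

theorem Diagram.NoHorizontal.ext {a b : Diagram n} (ha : a.NoHorizontal) (hb : b.NoHorizontal)
    (h : ∀ i j, a.Rel i j ↔ b.Rel i j) : a = b := by
  refine Diagram.ext (SimpleGraph.ext ?_)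
  funext u v
  rcases u with i | i <;> rcases v with j | j
  · exact propext ⟨fun h => (ha.1 _ _ h).elim, fun h => (hb.1 _ _ h).elim⟩
  · exact propext (h i j)
  · rw [a.graph.adj_comm, b.graph.adj_comm]
    exact propext (h j i)
  · exact propext ⟨fun h => (ha.2 _ _ h).elim, fun h => (hb.2 _ _ h).elim⟩

theorem stack_invariant {a b : Diagram n} {p : Vertex n ⊕ Vertex n → Prop}
    (hp : ∀ y z, p y → StackAdj a b y z → p z) {y z : Vertex n ⊕ Vertex n} (hy : p y)
    (h : (stack a b).Reachable y z) : p z := by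
  rw [SimpleGraph.reachable_iff_reflTransGen] at h
  induction h with
  | refl => exact hy
  | tail _ h2 ih => exact hp _ _ ih h2

/-- A path from the top vertex i can only descend along its arc in a and then along the next arc in
b; the predicate `p` lists the vertices on this path. -/
theorem Diagram.NoHorizontal.comp_rel {a b : Diagram n} (ha : a.NoHorizontal) (hb : b.NoHorizontal)
    (i k : Fin n) : (a.comp b).Rel i k ↔ ∃ j, a.Rel i j ∧ b.Rel j k := by
  constructor
  · rintro ⟨-, hik⟩
    let p : Vertex n ⊕ Vertex n → Prop := fun z => match z with
      | Sum.inl (Sum.inl i') => i' = i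
      | Sum.inl (Sum.inr j) => a.Rel i j
      | Sum.inr (Sum.inl j) => a.Rel i j
      | Sum.inr (Sum.inr k) => ∃ j, a.Rel i j ∧ b.Rel j k
    refine stack_invariant (p := p) ?_ (y := outer (Sum.inl i)) (z := outer (Sum.inr k)) rfl hik
    rintro y z hy (@⟨u, v, h⟩ | @⟨u, v, h⟩ | j | j)
    · rcases u with u | u <;> rcases v with v | v
      · exact (ha.1 _ _ h).elim
      · obtain rfl : u = i := hy
        exact h
      · exact Diagram.Rel.left_unique (k := u) h.symm hy
      · exact (ha.2 _ _ h).elim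
    · rcases u with u | u <;> rcases v with v | v
      · exact (hb.1 _ _ h).elim
      · exact ⟨u, hy, h⟩
      · obtain ⟨j, hj, hju⟩ := hy
        obtain rfl := Diagram.Rel.left_unique (i := v) h.symm hju
        exact hj
      · exact (hb.2 _ _ h).elim
    · exact hy
    · exact hy
  · rintro ⟨j, h1, h2⟩
    refine ⟨by simp, ?_⟩
    have e1 : (stack a b).Adj (outer (Sum.inl i)) (Sum.inl (Sum.inr j)) := StackAdj.upper h1
    have e2 : (stack a b).Adj (Sum.inl (Sum.inr j)) (Sum.inr (Sum.inl j)) := StackAdj.down j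
    have e3 : (stack a b).Adj (Sum.inr (Sum.inl j)) (outer (Sum.inr k)) := StackAdj.lower h2
    exact (e1.reachable.trans e2.reachable).trans e3.reachable

/-- A component without outer vertices is a single middle edge whose two ends are isolated in their
own diagrams. -/
theorem Diagram.NoHorizontal.loops_eq {a b : Diagram n} (ha : a.NoHorizontal)
    (hb : b.NoHorizontal) :
    loops a b = Nat.card {j : Fin n // (∀ i, ¬ a.Rel i j) ∧ ∀ k, ¬ b.Rel j k} := by
  have inv : ∀ j, (∀ i, ¬ a.Rel i j) → (∀ k, ¬ b.Rel j k) → ∀ z,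
      (stack a b).Reachable (Sum.inl (Sum.inr j)) z →
        z = Sum.inl (Sum.inr j) ∨ z = Sum.inr (Sum.inl j) := by
    intro j h1 h2 z
    refine stack_invariant (p := fun z => z = Sum.inl (Sum.inr j) ∨ z = Sum.inr (Sum.inl j)) ?_
      (.inl rfl)
    rintro y z hy (@⟨u, v, h⟩ | @⟨u, v, h⟩ | i | i)
    · obtain rfl : u = Sum.inr j := by simpa using hy
      rcases v with v | v
      · exact (h1 v h.symm).elim
      · exact (ha.2 _ _ h).elim
    · obtain rfl : u = Sum.inl j := by simpa using hy
      rcases v with v | v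
      · exact (hb.1 _ _ h).elim
      · exact (h2 v h).elim
    · obtain rfl : i = j := by simpa using hy
      exact .inr rfl
    · obtain rfl : i = j := by simpa using hy
      exact .inl rfl
  symm
  refine Nat.card_congr (Equiv.ofBijective (fun j =>
    ⟨(stack a b).connectedComponentMk (Sum.inl (Sum.inr j.1)), fun u hu => ?_⟩) ⟨?_, ?_⟩)
  · have := inv j.1 j.2.1 j.2.2 _ (SimpleGraph.ConnectedComponent.exact hu).symm
    rcases u with u | u <;> simp [outer] at this
  · intro j j' h
    have h : (stack a b).connectedComponentMk (Sum.inl (Sum.inr j.1)) =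
      (stack a b).connectedComponentMk (Sum.inl (Sum.inr j'.1)) := congrArg Subtype.val h
    have := inv j.1 j.2.1 j.2.2 _ (SimpleGraph.ConnectedComponent.exact h)
    exact Subtype.ext (by simpa [eq_comm] using this)
  · rintro ⟨c, hc⟩
    induction c using SimpleGraph.ConnectedComponent.ind with | _ v =>
    have hv : ∀ u, ¬ (stack a b).Reachable (outer u) v :=
      fun u hu => hc u (SimpleGraph.ConnectedComponent.sound hu)
    have main : ∀ j, (stack a b).Reachable (Sum.inl (Sum.inr j)) v →
        (∀ i, ¬ a.Rel i j) ∧ ∀ k, ¬ b.Rel j k := by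
      intro j hj
      refine ⟨fun i hi => hv (Sum.inl i) ?_, fun k hk => hv (Sum.inr k) ?_⟩
      · have e1 : (stack a b).Adj (outer (Sum.inl i)) (Sum.inl (Sum.inr j)) := StackAdj.upper hi
        exact e1.reachable.trans hj
      · have e2 : (stack a b).Adj (Sum.inr (Sum.inl j)) (Sum.inl (Sum.inr j)) := StackAdj.up j
        have e3 : (stack a b).Adj (outer (Sum.inr k)) (Sum.inr (Sum.inl j)) :=
          StackAdj.lower hk.symm
        exact (e3.reachable.trans e2.reachable).trans hj
    have hj : ∃ j, (stack a b).Reachable (Sum.inl (Sum.inr j)) v := by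
      rcases v with (v | v) | (v | v)
      · exact (hv (Sum.inl v) .rfl).elim
      · exact ⟨v, .rfl⟩
      · have e : (stack a b).Adj (Sum.inl (Sum.inr v)) (Sum.inr (Sum.inl v)) := StackAdj.down v
        exact ⟨v, e.reachable⟩
      · exact (hv (Sum.inr v) .rfl).elim
    obtain ⟨j, hj⟩ := hj
    exact ⟨⟨j, main j hj⟩, Subtype.ext (SimpleGraph.ConnectedComponent.sound hj)⟩

/-- The number of top vertices that are not joined to a bottom vertex. -/
noncomputable def Diagram.defect (a : Diagram n) : ℕ := Nat.card {i : Fin n // ∀ j, ¬ a.Rel i j}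

/-- A top vertex is unjoined in ab if it is unjoined in a, or if a sends it to a vertex unjoined in
b. The unjoined top vertices of b that a does not reach are exactly the ones counted by `loops`.
This identity makes the powers of x a coboundary. -/
theorem Diagram.NoHorizontal.loops_add_defect {a b : Diagram n} (ha : a.NoHorizontal)
    (hb : b.NoHorizontal) : loops a b + (a.comp b).defect = a.defect + b.defect := by
  classical
  rw [ha.loops_eq hb, Diagram.defect, Diagram.defect, Diagram.defect]
  simp only [Nat.card_eq_fintype_card, Fintype.card_subtype]
  have h1 : (Finset.univ.filter fun i => ∀ k, ¬ (a.comp b).Rel i k).card =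
      (Finset.univ.filter fun i => ∀ j, ¬ a.Rel i j).card +
        (Finset.univ.filter fun i => ∃ j, a.Rel i j ∧ ∀ k, ¬ b.Rel j k).card := by
    rw [← Finset.card_union_of_disjoint]
    · congr 1
      ext i
      simp only [Finset.mem_filter, Finset.mem_univ, true_and, Finset.mem_union, ha.comp_rel hb,
        not_exists, not_and]
      constructor
      · intro h
        by_cases hi : ∃ j, a.Rel i j
        · obtain ⟨j, hj⟩ := hi
          exact .inr ⟨j, hj, fun k => h k j hj⟩
        · exact .inl fun j hj => hi ⟨j, hj⟩
      · rintro (h | ⟨j, hj, h⟩) k j' hj'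
        · exact (h _ hj').elim
        · rw [← hj.right_unique hj']
          exact h k
    · rw [Finset.disjoint_filter]
      rintro i - h ⟨j, hj, -⟩
      exact h j hj
  have h2 : (Finset.univ.filter fun j => ∀ k, ¬ b.Rel j k).card =
      (Finset.univ.filter fun j => (∀ i, ¬ a.Rel i j) ∧ ∀ k, ¬ b.Rel j k).card +
        (Finset.univ.filter fun j => (∃ i, a.Rel i j) ∧ ∀ k, ¬ b.Rel j k).card := by
    rw [← Finset.card_union_of_disjoint]
    · congr 1
      ext j
      simp only [Finset.mem_filter, Finset.mem_univ, true_and, Finset.mem_union]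
      by_cases hj : ∃ i, a.Rel i j
      · simp [hj]
      · simp only [hj, false_and, or_false]
        exact ⟨fun h => ⟨fun i hi => hj ⟨i, hi⟩, h⟩, fun h => h.2⟩
    · rw [Finset.disjoint_filter]
      rintro j - h ⟨⟨i, hi⟩, -⟩
      exact h.1 i hi
  have h3 : (Finset.univ.filter fun i => ∃ j, a.Rel i j ∧ ∀ k, ¬ b.Rel j k).card =
      (Finset.univ.filter fun j => (∃ i, a.Rel i j) ∧ ∀ k, ¬ b.Rel j k).card := by
    refine Finset.card_bij (fun i hi => (Finset.mem_filter.1 hi).2.choose) ?_ ?_ ?_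
    · intro i hi
      have := (Finset.mem_filter.1 hi).2.choose_spec
      simp only [Finset.mem_filter, Finset.mem_univ, true_and]
      exact ⟨⟨i, this.1⟩, this.2⟩
    · intro i hi i' hi' h
      have e1 := (Finset.mem_filter.1 hi).2.choose_spec.1
      have e2 := (Finset.mem_filter.1 hi').2.choose_spec.1
      rw [← h] at e2
      exact e1.left_unique e2
    · intro j hj
      simp only [Finset.mem_filter, Finset.mem_univ, true_and] at hj
      obtain ⟨⟨i, hi⟩, hj⟩ := hj
      have hm : i ∈ Finset.univ.filter fun i => ∃ j, a.Rel i j ∧ ∀ k, ¬ b.Rel j k := by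
        simp only [Finset.mem_filter, Finset.mem_univ, true_and]
        exact ⟨j, hi, hj⟩
      exact ⟨i, hm, (Finset.mem_filter.1 hm).2.choose_spec.1.right_unique hi⟩
  omega

/-- The diagram without horizontal arcs that belongs to an injective relation. -/
def Diagram.ofRel (r : Fin n → Fin n → Prop) (hl : ∀ i j k, r i k → r j k → i = j)
    (hr : ∀ i j k, r i j → r i k → j = k) : Diagram n where
  graph :=
    { Adj := fun u v => match u, v with
        | Sum.inl i, Sum.inr j => r i j
        | Sum.inr j, Sum.inl i => r i j
        | _, _ => False
      symm := ⟨by rintro (i | i) (j | j) h <;> exact h⟩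
      loopless := ⟨by rintro (i | i) h <;> exact h⟩ }
  unique := by
    rintro (i | i) (j | j) (k | k) h h'
    · exact h.elim
    · exact h.elim
    · exact h'.elim
    · exact congrArg _ (hr _ _ _ h h')
    · exact congrArg _ (hl _ _ _ h h')
    · exact h'.elim
    · exact h.elim
    · exact h.elim

theorem Diagram.ofRel_noHorizontal (r : Fin n → Fin n → Prop) (hl : ∀ i j k, r i k → r j k → i = j)
    (hr : ∀ i j k, r i j → r i k → j = k) : (Diagram.ofRel r hl hr).NoHorizontal :=
  ⟨fun _ _ h => h, fun _ _ h => h⟩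

end Rel

/-! ### Solomon's decomposition into matrices over group algebras -/

section Solomon

variable {n : ℕ}

/-- The rows of `n` vertices from which `k` vertices are selected. -/
abbrev Selection (n k : ℕ) : Type := {T : Finset (Fin n) // T.card = k}

/-- The increasing enumeration of a selection. -/
def Selection.emb {k : ℕ} (T : Selection n k) : Fin k ↪ Fin n :=
  (T.1.orderEmbOfFin T.2).toEmbedding

theorem Selection.range_emb {k : ℕ} (T : Selection n k) : Set.range T.emb = T.1 :=
  T.1.range_orderEmbOfFin T.2

theorem Selection.ext_range {k : ℕ} {T U : Selection n k} (h : ∀ t, ∃ s, T.emb t = U.emb s) :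
    T = U := by
  refine Subtype.ext (Finset.eq_of_subset_of_card_le ?_ (by rw [T.2, U.2]))
  rw [← Finset.coe_subset, ← T.range_emb, ← U.range_emb]
  rintro _ ⟨t, rfl⟩
  obtain ⟨s, hs⟩ := h t
  exact ⟨s, hs.symm⟩

theorem Selection.exists_perm {k : ℕ} {f : Fin k → Fin n} (hf : Function.Injective f) :
    ∃ (U : Selection n k) (τ : Perm (Fin k)), ∀ t, U.emb (τ t) = f t := by
  let U : Selection n k := ⟨Finset.univ.image f, by
    rw [Finset.card_image_of_injective _ hf, Finset.card_univ, Fintype.card_fin]⟩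
  have h : ∀ t, ∃ s, U.emb s = f t := fun t => by
    have : f t ∈ Set.range U.emb := by
      rw [U.range_emb]; simp [U]
    exact this
  choose τ hτ using h
  have hinj : Function.Injective τ := fun s t hst => hf (by rw [← hτ, ← hτ, hst])
  exact ⟨U, Equiv.ofBijective τ (Finite.injective_iff_bijective.1 hinj), hτ⟩

/-- The diagram `a` joins the vertices selected by `T` and `U` according to `σ`. -/
def Diagram.Joins (a : Diagram n) {k : ℕ} (T U : Selection n k) (σ : Perm (Fin k)) : Prop :=
  ∀ t, a.Rel (T.emb (σ t)) (U.emb t)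

/-- The smallest diagram that joins the selected vertices according to `σ`. -/
def Diagram.joining {k : ℕ} (T U : Selection n k) (σ : Perm (Fin k)) : Diagram n :=
  Diagram.ofRel (fun i j => ∃ t, i = T.emb (σ t) ∧ j = U.emb t)
    (by
      rintro _ _ _ ⟨t, rfl, rfl⟩ ⟨s, rfl, h⟩
      rw [U.emb.injective h])
    (by
      rintro _ _ _ ⟨t, rfl, rfl⟩ ⟨s, h, rfl⟩
      rw [σ.injective (T.emb.injective h)])

theorem Diagram.joining_noHorizontal {k : ℕ} (T U : Selection n k) (σ : Perm (Fin k)) :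
    (Diagram.joining T U σ).NoHorizontal := Diagram.ofRel_noHorizontal _ _ _

theorem Diagram.joins_joining {k : ℕ} (T U : Selection n k) (σ : Perm (Fin k)) :
    (Diagram.joining T U σ).Joins T U σ := fun t => ⟨t, rfl, rfl⟩

theorem Diagram.le_of_joins_joining {k k' : ℕ} {T U : Selection n k} {σ : Perm (Fin k)}
    {T' U' : Selection n k'} {σ' : Perm (Fin k')} (h : (Diagram.joining T U σ).Joins T' U' σ') :
    k' ≤ k := by
  choose f hf using h
  have : Function.Injective f := fun s t hst => U'.emb.injective (by rw [(hf s).2, (hf t).2, hst])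
  simpa using Fintype.card_le_of_injective f this

/-- A smallest joining diagram has exactly k arcs, so joining k selected pairs uses all of them.
Together with `Diagram.le_of_joins_joining` this gives the triangularity. -/
theorem Diagram.eq_of_joins_joining {k : ℕ} {T U T' U' : Selection n k} {σ σ' : Perm (Fin k)}
    (h : (Diagram.joining T U σ).Joins T' U' σ') : T' = T ∧ U' = U ∧ σ' = σ := by
  choose f hf using h
  obtain rfl : U' = U := Selection.ext_range fun t => ⟨_, (hf t).2⟩
  obtain rfl : T' = T := Selection.ext_range fun t => ⟨σ (f (σ'.symm t)), by
    have := (hf (σ'.symm t)).1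
    rwa [σ'.apply_symm_apply] at this⟩
  refine ⟨rfl, rfl, Equiv.ext fun t => ?_⟩
  have h1 := U'.emb.injective (hf t).2
  have h2 := T'.emb.injective (hf t).1
  rw [h2, ← h1]

theorem Diagram.NoHorizontal.exists_joining {a : Diagram n} (ha : a.NoHorizontal) :
    ∃ (k : Fin (n + 1)) (T U : Selection n k) (σ : Perm (Fin k)), Diagram.joining T U σ = a := by
  classical
  let D : Finset (Fin n) := Finset.univ.filter fun i => ∃ j, a.Rel i j
  have hk : D.card < n + 1 := Nat.lt_succ_of_le (by simpa using D.card_le_univ)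
  let T : Selection n D.card := ⟨D, rfl⟩
  have hT : ∀ i, (∃ t, T.emb t = i) ↔ ∃ j, a.Rel i j := fun i => by
    have : i ∈ Set.range T.emb ↔ i ∈ D := by rw [T.range_emb]; rfl
    simpa [D] using this
  have hf : ∀ t, ∃ j, a.Rel (T.emb t) j := fun t => (hT _).1 ⟨t, rfl⟩
  choose f hf using hf
  obtain ⟨U, τ, hτ⟩ := Selection.exists_perm (f := f)
    fun s t hst => T.emb.injective ((hf s).left_unique (hst ▸ hf t))
  -- The permutation τ carries top positions to bottom positions, while `Diagram.joining` indexes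
  -- arcs by the bottom position; hence the inverse.
  refine ⟨⟨D.card, hk⟩, T, U, τ.symm,
    (Diagram.joining_noHorizontal _ _ _).ext ha fun i j => ⟨?_, fun h => ?_⟩⟩
  · rintro ⟨t, rfl, rfl⟩
    have h := hf (τ.symm t)
    rwa [← hτ, τ.apply_symm_apply] at h
  · obtain ⟨t, rfl⟩ := (hT i).2 ⟨j, h⟩
    exact ⟨τ t, by rw [τ.symm_apply_apply], by rw [hτ]; exact h.right_unique (hf t)⟩

open scoped Classical in
/-- The sum of the permutations according to which `a` joins the selected vertices. -/
noncomputable def Diagram.entry (F : Type*) [Field F] (a : Diagram n) {k : ℕ}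
    (T U : Selection n k) : MonoidAlgebra F (Perm (Fin k)) :=
  ∑ σ with a.Joins T U σ, MonoidAlgebra.of F _ σ

/-- When ab joins T and V according to ρ, the k paths cross the middle row in k distinct vertices.
These determine U and a unique factorisation ρ = σ τ, so the terms on both sides match bijectively.
-/
theorem Diagram.NoHorizontal.entry_comp {F : Type*} [Field F] {a b : Diagram n}
    (ha : a.NoHorizontal) (hb : b.NoHorizontal) {k : ℕ} (T V : Selection n k) :
    ∑ U, a.entry F T U * b.entry F U V = (a.comp b).entry F T V := by
  classical
  have h1 : ∀ U : Selection n k, a.entry F T U * b.entry F U V =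
      ∑ p : Perm (Fin k) × Perm (Fin k) with a.Joins T U p.1 ∧ b.Joins U V p.2,
        MonoidAlgebra.of F _ (p.1 * p.2) := by
    intro U
    rw [Diagram.entry, Diagram.entry, Finset.sum_mul_sum, ← Finset.sum_product',
      ← Finset.univ_product_univ, Finset.filter_product]
    simp_rw [map_mul]
  simp_rw [h1]
  rw [Finset.sum_sigma', Diagram.entry]
  refine Finset.sum_bij (fun q _ => q.2.1 * q.2.2) ?_ ?_ ?_ (fun _ _ => rfl)
  · rintro ⟨U, σ, τ⟩ h
    simp only [Finset.mem_sigma, Finset.mem_filter, Finset.mem_univ, true_and] at h ⊢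
    intro t
    rw [ha.comp_rel hb]
    exact ⟨U.emb (τ t), h.1 (τ t), h.2 t⟩
  · rintro ⟨U, σ, τ⟩ h ⟨U', σ', τ'⟩ h' (e : σ * τ = σ' * τ')
    simp only [Finset.mem_sigma, Finset.mem_filter, Finset.mem_univ, true_and] at h h'
    have key : ∀ t, U.emb (τ t) = U'.emb (τ' t) := by
      intro t
      have e1 := h.1 (τ t)
      have e2 := h'.1 (τ' t)
      rw [← Perm.mul_apply, e, Perm.mul_apply] at e1
      exact e1.right_unique e2
    obtain rfl : U = U' := Selection.ext_range fun t => ⟨τ' (τ.symm t), by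
      rw [← key, τ.apply_symm_apply]⟩
    obtain rfl : τ = τ' := Equiv.ext fun t => U.emb.injective (key t)
    obtain rfl := mul_right_cancel e
    rfl
  · intro ρ h
    simp only [Finset.mem_filter, Finset.mem_univ, true_and] at h
    have h : ∀ t, ∃ j, a.Rel (T.emb (ρ t)) j ∧ b.Rel j (V.emb t) := fun t =>
      (ha.comp_rel hb _ _).1 (h t)
    choose f hf using h
    obtain ⟨U, τ, hτ⟩ := Selection.exists_perm (f := f)
      fun s t hst => V.emb.injective ((hf s).2.right_unique (hst ▸ (hf t).2))
    refine ⟨⟨U, ρ * τ⁻¹, τ⟩, ?_, by simp⟩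
    simp only [Finset.mem_sigma, Finset.mem_filter, Finset.mem_univ, true_and]
    refine ⟨fun t => ?_, fun t => ?_⟩
    · have := (hf (τ⁻¹ t)).1
      rw [← hτ, show τ (τ⁻¹ t) = t from τ.apply_symm_apply t] at this
      exact this
    · rw [hτ]
      exact (hf t).2

variable (F : Type*) [Field F] (x : F)

/-- The direct product of the matrix algebras over the group algebras of the symmetric groups. -/
abbrev SelectionMatrices (n : ℕ) : Type _ :=
  Π k : Fin (n + 1), Matrix (Selection n k) (Selection n k) (MonoidAlgebra F (Perm (Fin k)))

/-- The image of a diagram under the decomposition of the diagram algebra. -/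
noncomputable def Diagram.matrices (a : Diagram n) : SelectionMatrices F n :=
  fun _ => Matrix.of fun T U => x ^ a.defect • a.entry F T U

/-- The factor x^(d(a)) in `Diagram.matrices` absorbs the loop count through
`Diagram.NoHorizontal.loops_add_defect`. -/
theorem Diagram.NoHorizontal.matrices_mul {a b : Diagram n} (ha : a.NoHorizontal)
    (hb : b.NoHorizontal) :
    a.matrices F x * b.matrices F x = x ^ loops a b • (a.comp b).matrices F x := by
  funext k
  ext1 T V
  simp only [Pi.mul_apply, Matrix.mul_apply, Diagram.matrices, Matrix.of_apply, Pi.smul_apply,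
    Matrix.smul_apply, smul_mul_smul_comm, ← Finset.smul_sum, ha.entry_comp hb, smul_smul,
    ← pow_add, ha.loops_add_defect hb]

/-- The linear map that extends `Diagram.matrices` to the diagram algebra. -/
noncomputable def toMatrices (n : ℕ) : DiagramAlgebra n F x →ₗ[F] SelectionMatrices F n :=
  (DiagramAlgebra.basis n x).constr F fun a => a.matrices F x

theorem toMatrices_of (a : Diagram n) : toMatrices F x n (.of x a) = a.matrices F x := by
  rw [toMatrices, ← DiagramAlgebra.basis_apply, Module.Basis.constr_basis]

theorem of_mem_noHorizontalSubalgebra {a : Diagram n} (ha : a.NoHorizontal) :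
    DiagramAlgebra.of x a ∈ noHorizontalSubalgebra n F x :=
  Submodule.subset_span ⟨a, ha, rfl⟩

theorem toMatrices_mul {f g : DiagramAlgebra n F x} (hf : f ∈ noHorizontalSubalgebra n F x)
    (hg : g ∈ noHorizontalSubalgebra n F x) :
    toMatrices F x n (f * g) = toMatrices F x n f * toMatrices F x n g := by
  change f ∈ Submodule.span F (DiagramAlgebra.of x '' {a : Diagram n | a.NoHorizontal}) at hf
  change g ∈ Submodule.span F (DiagramAlgebra.of x '' {a : Diagram n | a.NoHorizontal}) at hg
  induction hf using Submodule.span_induction with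
  | zero => simp
  | add f f' _ _ hf hf' => rw [add_mul, map_add, map_add, hf, hf', add_mul]
  | smul r f _ hf => rw [smul_mul_assoc, map_smul, map_smul, hf, smul_mul_assoc]
  | mem f hf =>
    obtain ⟨a, ha, rfl⟩ := hf
    induction hg using Submodule.span_induction with
    | zero => simp
    | add g g' _ _ hg hg' => rw [mul_add, map_add, map_add, hg, hg', mul_add]
    | smul r g _ hg => rw [mul_smul_comm, map_smul, map_smul, hg, mul_smul_comm]
    | mem g hg =>
      obtain ⟨b, hb, rfl⟩ := hg
      rw [DiagramAlgebra.of_mul_of, map_smul, toMatrices_of, toMatrices_of, toMatrices_of,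
        Diagram.NoHorizontal.matrices_mul F x ha hb]

theorem mem_of_single_mem [∀ k, DecidableEq (Selection n k)]
    {R : Submodule F (SelectionMatrices F n)}
    {y : SelectionMatrices F n} (h : ∀ k, y k ≠ 0 → ∀ (T U : Selection n k) (σ : Perm (Fin k)),
      (Pi.single k (Matrix.single T U (MonoidAlgebra.of F _ σ)) : SelectionMatrices F n) ∈ R) :
    y ∈ R := by
  rw [← Finset.univ_sum_single y]
  refine sum_mem fun k _ => ?_
  by_cases hk : y k = 0
  · rw [hk, Pi.single_zero]
    exact zero_mem _
  · rw [Matrix.matrix_eq_sum_single (y k), ← LinearMap.coe_single (R := F), map_sum]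
    refine sum_mem fun T _ => ?_
    rw [map_sum]
    refine sum_mem fun U _ => ?_
    generalize y k T U = z
    induction z using MonoidAlgebra.induction_on with
    | of σ => exact h k hk T U σ
    | add z z' hz hz' =>
      rw [Matrix.single_add, map_add]
      exact add_mem hz hz'
    | smul c z hz =>
      rw [← Matrix.smul_single, map_smul]
      exact R.smul_mem c hz

variable {x}

/-- The matrices of `Diagram.joining T U σ` have the single entry x^d σ at level k and vanish above
it. The lower levels lie in the range by induction, and x^d is invertible; this is where x ≠ 0
enters. -/
theorem single_mem_range (hx : x ≠ 0) (m : ℕ) : ∀ (k : Fin (n + 1)), k = m →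
    ∀ (T U : Selection n k) (σ : Perm (Fin k)),
      (Pi.single k (Matrix.single T U (MonoidAlgebra.of F _ σ)) : SelectionMatrices F n) ∈
        (noHorizontalSubalgebra n F x).toSubmodule.map (toMatrices F x n) := by
  classical
  induction m using Nat.strong_induction_on with
  | _ m ih =>
  rintro k rfl T U σ
  set R := (noHorizontalSubalgebra n F x).toSubmodule.map (toMatrices F x n) with hR
  have hlow : ∀ y : SelectionMatrices F n, (∀ k', k ≤ k' → y k' = 0) → y ∈ R := fun y hy =>
    mem_of_single_mem F fun k' hk => ih k' (not_le.1 fun h => hk (hy k' h)) k' rfl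
  set a := Diagram.joining T U σ with ha
  have hxd : x ^ a.defect ≠ 0 := pow_ne_zero _ hx
  have ha' : a.matrices F x ∈ R := ⟨_, of_mem_noHorizontalSubalgebra F x
    (Diagram.joining_noHorizontal T U σ), toMatrices_of F x a⟩
  have hd : a.matrices F x - x ^ a.defect •
      (Pi.single k (Matrix.single T U (MonoidAlgebra.of F _ σ)) : SelectionMatrices F n) ∈ R := by
    refine hlow _ fun k' hk => ?_
    rw [Pi.sub_apply, sub_eq_zero, Pi.smul_apply]
    ext1 T' U'
    rw [Diagram.matrices, Matrix.of_apply, Matrix.smul_apply]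
    congr 1
    rw [Diagram.entry]
    rcases hk.eq_or_lt with rfl | hk
    · rw [Pi.single_eq_same, Matrix.single_apply]
      split_ifs with h
      · obtain ⟨rfl, rfl⟩ := h
        have : (Finset.univ.filter fun σ' => a.Joins T U σ') = {σ} := by
          ext σ'
          simp only [Finset.mem_filter, Finset.mem_univ, true_and, Finset.mem_singleton]
          exact ⟨fun h => (Diagram.eq_of_joins_joining h).2.2,
            fun h => h ▸ Diagram.joins_joining T U σ⟩
        rw [this, Finset.sum_singleton]
      · rw [Finset.filter_false_of_mem, Finset.sum_empty]
        intro σ' _ h'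
        obtain ⟨rfl, rfl, -⟩ := Diagram.eq_of_joins_joining h'
        exact h ⟨rfl, rfl⟩
    · rw [Pi.single_eq_of_ne hk.ne', Matrix.zero_apply, Finset.filter_false_of_mem,
        Finset.sum_empty]
      intro σ' _ h'
      exact absurd (Diagram.le_of_joins_joining h') (not_le.2 hk)
  have := R.smul_mem (x ^ a.defect)⁻¹ (sub_mem ha' hd)
  rwa [sub_sub_cancel, smul_smul, inv_mul_cancel₀ hxd, one_smul] at this

theorem map_toMatrices_eq_top (hx : x ≠ 0) :
    (noHorizontalSubalgebra n F x).toSubmodule.map (toMatrices F x n) = ⊤ := by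
  classical
  exact eq_top_iff.2 fun y _ => mem_of_single_mem F fun k _ => single_mem_range F hx _ k rfl

/-- The joining diagrams span, and their parameters (k, T, U, σ) also index a basis of the matrix
product. With surjectivity this bound gives injectivity, so no separate proof of linear independence
is needed. -/
theorem finrank_noHorizontalSubalgebra_le (x : F) :
    Module.finrank F (noHorizontalSubalgebra n F x) ≤ Module.finrank F (SelectionMatrices F n) := by
  classical
  let Q := Σ k : Fin (n + 1), Selection n k × Selection n k × Perm (Fin k)
  let b : Q → DiagramAlgebra n F x := fun q => .of x (Diagram.joining q.2.1 q.2.2.1 q.2.2.2)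
  have h1 : (noHorizontalSubalgebra n F x).toSubmodule = Submodule.span F (Set.range b) := by
    refine congrArg (Submodule.span F) (Set.ext fun f => ⟨?_, ?_⟩)
    · rintro ⟨a, ha, rfl⟩
      obtain ⟨k, T, U, σ, rfl⟩ := Diagram.NoHorizontal.exists_joining ha
      exact ⟨⟨k, T, U, σ⟩, rfl⟩
    · rintro ⟨q, rfl⟩
      exact ⟨_, Diagram.joining_noHorizontal _ _ _, rfl⟩
  have h2 : Module.finrank F (SelectionMatrices F n) = Fintype.card Q := by
    rw [Module.finrank_pi_fintype, Fintype.card_sigma]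
    refine Finset.sum_congr rfl fun k _ => ?_
    rw [Module.finrank_matrix, Fintype.card_prod, Fintype.card_prod, mul_assoc]
    congr 2
    exact Module.finrank_eq_card_basis (MonoidAlgebra.basis _ F)
  rw [h2, ← Subalgebra.finrank_toSubmodule, h1]
  exact finrank_range_le_card b

theorem isSplitSemisimple_noHorizontalSubalgebra [CharZero F] (hx : x ≠ 0) :
    IsSplitSemisimple F (noHorizontalSubalgebra n F x) := by
  let φ : noHorizontalSubalgebra n F x →ₗ[F] SelectionMatrices F n :=
    (toMatrices F x n).comp (noHorizontalSubalgebra n F x).val.toLinearMap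
  have hsurj : Function.Surjective φ := fun y => by
    have : y ∈ (noHorizontalSubalgebra n F x).toSubmodule.map (toMatrices F x n) := by
      rw [map_toMatrices_eq_top F hx]; trivial
    obtain ⟨f, hf, rfl⟩ := this
    exact ⟨⟨f, hf⟩, rfl⟩
  have hmul : ∀ f g, φ (f * g) = φ f * φ g := fun f g => toMatrices_mul F x f.2 g.2
  have : Finite (Diagram n) :=
    Finite.of_injective Diagram.graph fun a b h => Diagram.ext h
  have : Module.Finite F (DiagramAlgebra n F x) :=
    Module.Finite.of_basis (DiagramAlgebra.basis n x)
  have hrank := le_antisymm (finrank_noHorizontalSubalgebra_le (n := n) F x)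
    (LinearMap.finrank_le_finrank_of_surjective hsurj)
  have hinj := (LinearMap.injective_iff_surjective_of_finrank_eq_finrank hrank).2 hsurj
  -- A surjective multiplicative map is unital: φ 1 acts as a left identity on a preimage of 1.
  have hone : φ 1 = 1 := by
    obtain ⟨f, hf⟩ := hsurj 1
    rw [← mul_one (φ 1), ← hf, ← hmul, one_mul]
  have hne : ∀ k : Fin (n + 1), Nonempty (Selection n k) := fun k => by
    obtain ⟨T, -, hT⟩ := Finset.exists_subset_card_eq
      (s := (Finset.univ : Finset (Fin n))) (n := k) (by simpa using Nat.le_of_lt_succ k.2)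
    exact ⟨T, hT⟩
  exact IsSplitSemisimple.of_pi_matrix_of_split
    (J := Fin (n + 1)) (m := fun k => Selection n k) (R := fun k => MonoidAlgebra F (Perm (Fin k)))
    (fun k => isSplitSemisimple_monoidAlgebra_perm (Fin k))
    (AlgEquiv.ofLinearEquiv (LinearEquiv.ofBijective φ ⟨hinj, hsurj⟩) hone hmul)

end Solomon

end LoopBrauer

theorem mainTheorem2 (F : Type*) [Field F] [CharZero F] (n : ℕ) (x : F) (hx : x ≠ 0) :
    LoopBrauer.IsSplitSemisimple F (LoopBrauer.noHorizontalSubalgebra n F x) :=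
  LoopBrauer.isSplitSemisimple_noHorizontalSubalgebra F hx
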